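/- For positive integers $s_1,\dots,s_r$ and an integer $n\ge 0$, define the rational numbers $$H_n(s_1,\dots,s_r)=\sum_{1\le k_1<\cdots<k_r\le n}\frac{1}{k_1^{s_1}\cdots k_r^{s_r}},\qquad S_n(s_1,\dots,s_r)=\sum_{1\le k_1\le\cdots\le k_r\le n}\frac{1}{k_1^{s_1}\cdots k_r^{s_r}},$$ and let $\{1\}^m$ denote the sequence consisting of $m$ ones. Let $B_k$ be the Bernoulli numbers, $\frac{x}{e^x-1}=\sum_{k\ge 0}B_k\frac{x^k}{k!}$. For rational numbers $x,y$, a prime $p$ and $m\ge 1$, write $x\equiv y\pmod{p^m}$ if $x-y=p^m z$ with a rational number $z$ whose denominator is not divisible by $p$. Let $a,b\ge 0$ be integers and let $p>a+b+3$ be a prime. If $a+b$ is odd, then $$S_{p-1}(\{1\}^a,2,\{1\}^b)\equiv H_{p-1}(\{1\}^a,2,\{1\}^b)\equiv \frac{(-1)^b}{a+b+2}\binom{a+b+2}{a+1}B_{p-a-b-2}\pmod{p}.$$ If $a+b$ is even, then $$S_{p-1}(\{1\}^a,2,\{1\}^b)\equiv \frac{p\,B_{p-a-b-3}}{2(a+b+3)}\left(1+(-1)^a\binom{a+b+3}{a+2}\right)\pmod{p^2},$$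 $$H_{p-1}(\{1\}^a,2,\{1\}^b)\equiv \frac{p\,B_{p-a-b-3}}{2(a+b+3)}\left(1+(-1)^a\binom{a+b+3}{b+2}\right)\pmod{p^2}.$$ -/

import Mathlib

/-- The multiple harmonic sum
`H_n(s₁, …, s_r) = ∑_{1 ≤ k₁ < ⋯ < k_r ≤ n} ∏ i, 1 / k_i ^ s_i`, as a rational number. -/
def multHarmonicSum (n : ℕ) (s : List ℕ) : ℚ :=
  ∑ k ∈ (Fintype.piFinset fun _ : Fin s.length => Finset.Icc 1 n).filter
      (fun k => ∀ i j : Fin s.length, i < j → k i < k j),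
    ∏ i : Fin s.length, 1 / (k i : ℚ) ^ s.get i

/-- The multiple star (non-strict) harmonic sum
`S_n(s₁, …, s_r) = ∑_{1 ≤ k₁ ≤ ⋯ ≤ k_r ≤ n} ∏ i, 1 / k_i ^ s_i`, as a rational number. -/
def multStarHarmonicSum (n : ℕ) (s : List ℕ) : ℚ :=
  ∑ k ∈ (Fintype.piFinset fun _ : Fin s.length => Finset.Icc 1 n).filter
      (fun k => ∀ i j : Fin s.length, i < j → k i ≤ k j),
    ∏ i : Fin s.length, 1 / (k i : ℚ) ^ s.get i

/-- Congruence of rational numbers modulo the prime power `p ^ m`: the difference `x - y` is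
`p ^ m` times a `p`-integral rational number (one with a denominator prime to `p`). -/
def RatCongr (p m : ℕ) (x y : ℚ) : Prop :=
  ∃ u v : ℤ, ¬ (p : ℤ) ∣ v ∧ x - y = (p : ℚ) ^ m * ((u : ℚ) / (v : ℚ))

/-- The sequence `({1}^a, 2, {1}^b)`. -/
def onesTwoOnes (a b : ℕ) : List ℕ :=
  List.replicate a 1 ++ 2 :: List.replicate b 1

/-! ### Strict and non-strict multiple sums as nested sums. -/

open Finset

/-! Write `S(a,b)` and `H(a,b)` for the two sums with `n = p - 1`, `B_i` for Bernoulli numbers, and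
`D(s,t)` for `doubleHarmonic (p - 1) s t`.

Star sums are binomial transforms: `S(a,b) = ∑ (-1)^(k-1) C(p-1,k) f(k)` with `f(k) = k^{-(b+1)}
∑_{j ≤ k} j^{-(a+1)}` (`intervalSum_Icc_onesTwoOnes`). Since `(-1)^k C(p-1,k) ≡ 1 - p ∑_{j ≤ k} 1/j`
mod `p²`, this gives `S(a,b) ≡ p T - D(a+1,b+1)` mod `p²`, where `T` is `f(k)` weighted by the
harmonic number of `k`. Modulo `p` only `-D(a+1,b+1)` remains, and Faulhaber's formula expresses it
by one Bernoulli number (`doubleHarmonic_sub_mem`).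

For even `a + b` that Bernoulli number has odd index and vanishes, so one more power of `p` is
needed. The reflection `k ↦ p - k` expresses `2T` mod `p`, and `2D` mod `p²`, through double sums of
odd weight and the power sum of weight `a + b + 2`. Newton's identity gives that power sum mod `p²`
(`mul_harmonicPow_even_sub_mem`).

The strict sums follow by duality. Generating functions of the all-ones sums write `S(a,b)` as
`(-1)^(a+b) H(b,a)` plus products of a strict sum with all-ones star sums, at least one of them
nonempty (`intervalSum_onesTwoOnes_Icc_sub_Ioo_eq_sum`). The extra terms vanish mod `p`, and mod
`p²` when `a + b` is even. -/

/-- The nested sum `∑ ∏ i, 1 / k_i ^ s_i` over the sequences with `k₁ ∈ I m n` and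
`k_{i+1} ∈ I k_i n`. -/
def intervalSum (I : ℕ → ℕ → Finset ℕ) : ℕ → ℕ → List ℕ → ℚ
  | _, _, [] => 1
  | m, n, t :: s => ∑ k ∈ I m n, ((k : ℚ)⁻¹) ^ t * intervalSum I k n s

/-- Splits a nested sum at its distinguished entry; `hI` is exactly what interchanging two
consecutive summations requires. -/
theorem intervalSum_append_cons {I : ℕ → ℕ → Finset ℕ}
    (hI : ∀ m n j k, j ∈ I m n ∧ k ∈ I j n ↔ j ∈ I m k ∧ k ∈ I m n)
    (u v : List ℕ) (t m n : ℕ) :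
    intervalSum I m n (u ++ t :: v) =
      ∑ k ∈ I m n, ((k : ℚ)⁻¹) ^ t * intervalSum I m k u * intervalSum I k n v := by
  induction u generalizing m with
  | nil => simp [intervalSum]
  | cons c u ih =>
    simp only [List.cons_append, intervalSum, ih, mul_sum, sum_mul]
    rw [sum_comm' (hI m n)]
    exact sum_congr rfl fun k _ => sum_congr rfl fun j _ => by ring

theorem sum_filter_piFinset_eq_intervalSum {I : ℕ → ℕ → Finset ℕ} (r : ℕ → ℕ → Prop)
    [DecidableRel r] [IsTrans ℕ r] (hI : ∀ m n k, k ∈ I m n ↔ r m k ∧ r k n)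
    (m n : ℕ) (s : List ℕ) :
    ∑ k ∈ (Fintype.piFinset fun _ : Fin s.length => I m n).filter
        (fun k => ∀ i j : Fin s.length, i < j → r (k i) (k j)),
      ∏ i : Fin s.length, 1 / (k i : ℚ) ^ s.get i = intervalSum I m n s := by
  induction s generalizing m with
  | nil =>
    rw [filter_true_of_mem (fun _ _ i => i.elim0)]
    simp [intervalSum]
  | cons t s ih =>
    simp only [intervalSum, ← ih, mul_sum]
    rw [sum_sigma']
    symm
    -- The smallest index is split off; transitivity of `r` keeps the tail inside the original
    -- interval.
    refine sum_bij' (fun x _ => Fin.cons x.1 x.2) (fun k _ => ⟨k 0, Fin.tail k⟩) ?_ ?_ ?_ ?_ ?_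
    · rintro ⟨x, k⟩ h
      simp only [mem_sigma, mem_filter, Fintype.mem_piFinset, hI] at h ⊢
      obtain ⟨hx, hk, hr⟩ := h
      refine ⟨fun i => ?_, fun i j hij => ?_⟩
      · refine Fin.cases ?_ (fun i => ?_) i
        · exact hx
        · exact ⟨_root_.trans hx.1 (hk i).1, (hk i).2⟩
      · revert hij
        refine Fin.cases ?_ (fun i => ?_) i <;> refine Fin.cases ?_ (fun j => ?_) j
        · intro h; exact absurd h (lt_irrefl _)
        · intro _; exact (hk j).1
        · intro h; exact absurd h (Fin.not_lt_zero _)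
        · intro h; exact hr i j (Fin.succ_lt_succ_iff.1 h)
    · intro k h
      simp only [mem_sigma, mem_filter, Fintype.mem_piFinset, hI] at h ⊢
      exact ⟨h.1 0, fun i => ⟨h.2 _ _ (Fin.succ_pos i), (h.1 i.succ).2⟩,
        fun i j hij => h.2 _ _ (Fin.succ_lt_succ_iff.2 hij)⟩
    · rintro ⟨x, k⟩ h
      rfl
    · intro k h
      exact Fin.cons_self_tail k
    · rintro ⟨x, k⟩ h
      simp only [List.length_cons]
      rw [Fin.prod_univ_succ]
      simp

theorem multHarmonicSum_eq_intervalSum (n : ℕ) (s : List ℕ) :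
    multHarmonicSum n s = intervalSum Ioo 0 (n + 1) s := by
  rw [← sum_filter_piFinset_eq_intervalSum (· < ·) (fun _ _ _ => mem_Ioo)]
  have : Icc 1 n = Ioo 0 (n + 1) := by ext; simp; omega
  rw [multHarmonicSum, this]

theorem multStarHarmonicSum_eq_intervalSum (n : ℕ) (s : List ℕ) :
    multStarHarmonicSum n s = intervalSum Icc 1 n s := by
  rw [← sum_filter_piFinset_eq_intervalSum (· ≤ ·) (fun _ _ _ => mem_Icc)]
  rfl

theorem intervalSum_Icc_append_cons (u v : List ℕ) (t m n : ℕ) :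
    intervalSum Icc m n (u ++ t :: v) =
      ∑ k ∈ Icc m n, ((k : ℚ)⁻¹) ^ t * intervalSum Icc m k u * intervalSum Icc k n v :=
  intervalSum_append_cons (fun m n j k => by simp only [mem_Icc]; omega) u v t m n

theorem intervalSum_Ioo_append_cons (u v : List ℕ) (t m n : ℕ) :
    intervalSum Ioo m n (u ++ t :: v) =
      ∑ k ∈ Ioo m n, ((k : ℚ)⁻¹) ^ t * intervalSum Ioo m k u * intervalSum Ioo k n v :=
  intervalSum_append_cons (fun m n j k => by simp only [mem_Ioo]; omega) u v t m n

theorem intervalSum_Icc_append_singleton (u : List ℕ) (t m n : ℕ) :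
    intervalSum Icc m n (u ++ [t]) = ∑ k ∈ Icc m n, ((k : ℚ)⁻¹) ^ t * intervalSum Icc m k u := by
  simp [intervalSum_Icc_append_cons, intervalSum]

/-! ### Star sums as binomial transforms. -/

/-- The signed binomial transform `n ↦ ∑_{k=1}^n (-1)^{k-1} (n choose k) f(k)`. -/
def binomTransform (f : ℕ → ℚ) (n : ℕ) : ℚ :=
  ∑ k ∈ Icc 1 n, (-1) ^ (k - 1) * (n.choose k : ℚ) * f k

theorem binomTransform_one {n : ℕ} (hn : 1 ≤ n) : binomTransform (fun _ => 1) n = 1 := by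
  have h := Int.alternating_sum_range_choose_of_ne (n := n) (by omega)
  rw [range_eq_Ico, sum_eq_sum_Ico_succ_bot (by omega)] at h
  have h' : (∑ k ∈ Icc 1 n, ((-1) ^ k * (n.choose k) : ℤ)) = -1 := by
    have : Ico (0 + 1) (n + 1) = Icc 1 n := by ext; simp
    rw [this] at h
    simp at h
    linarith
  have h2 : (∑ k ∈ Icc 1 n, ((-1) ^ k * (n.choose k) : ℚ)) = -1 := by exact_mod_cast h'
  have h3 := congrArg Neg.neg h2
  rw [neg_neg, ← sum_neg_distrib] at h3
  refine (sum_congr rfl fun k hk => ?_).trans h3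
  obtain ⟨k, rfl⟩ : ∃ j, k = j + 1 := ⟨k - 1, by simp at hk; omega⟩
  simp [pow_succ]

/-- Absorption turns `C(m,k)/m` into `C(m-1,k-1)/k`, and the hockey-stick identity sums it. -/
theorem sum_Icc_choose_div {n k : ℕ} (hk : 1 ≤ k) :
    ∑ m ∈ Icc k n, (m : ℚ)⁻¹ * (m.choose k : ℚ) = (n.choose k : ℚ) * (k : ℚ)⁻¹ := by
  obtain ⟨k, rfl⟩ : ∃ j, k = j + 1 := ⟨k - 1, by omega⟩
  have key : ∀ m ∈ Icc (k + 1) n, (m : ℚ)⁻¹ * (m.choose (k + 1) : ℚ) =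
      ((m - 1).choose k : ℚ) * ((k + 1 : ℕ) : ℚ)⁻¹ := by
    intro m hm
    obtain ⟨m, rfl⟩ : ∃ j, m = j + 1 := ⟨m - 1, by simp at hm; omega⟩
    have := Nat.add_one_mul_choose_eq m k
    have h : ((m + 1 : ℕ) : ℚ) * (m.choose k) = ((m + 1).choose (k + 1)) * ((k + 1 : ℕ) : ℚ) := by
      exact_mod_cast this
    have h1 : ((m + 1 : ℕ) : ℚ) ≠ 0 := by positivity
    have h2 : ((k + 1 : ℕ) : ℚ) ≠ 0 := by positivity
    rw [Nat.add_sub_cancel]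
    field_simp
    linarith
  rw [sum_congr rfl key, ← sum_mul]
  congr 1
  rcases n with _ | n
  · simp
  rw [← Nat.sum_Icc_choose n k]
  push_cast
  refine sum_nbij' (fun i => i - 1) (fun i => i + 1) ?_ ?_ ?_ ?_ ?_ <;> simp <;> omega

/-- Appending an entry `1` to a star sum thus divides the transformed function by `k`. -/
theorem sum_inv_mul_binomTransform (f : ℕ → ℚ) (n : ℕ) :
    ∑ m ∈ Icc 1 n, (m : ℚ)⁻¹ * binomTransform f m = binomTransform (fun k => (k : ℚ)⁻¹ * f k) n := by
  simp only [binomTransform, mul_sum]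
  rw [sum_comm' (t' := Icc 1 n) (s' := fun k => Icc k n) (by simp; omega)]
  refine sum_congr rfl fun k hk => ?_
  rw [← mul_assoc, mul_assoc _ _ ((k : ℚ)⁻¹), ← sum_Icc_choose_div (mem_Icc.1 hk).1, mul_sum,
    sum_mul]
  exact sum_congr rfl fun j _ => by ring

theorem sum_Icc_neg_one_pow_choose {n j : ℕ} (hj : 1 ≤ j) (hjn : j ≤ n) :
    ∑ k ∈ Icc j n, (-1 : ℚ) ^ (k - 1) * (n.choose k : ℚ) =
      (n : ℚ)⁻¹ * ((-1) ^ (j - 1) * (n.choose j : ℚ) * j) := by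
  obtain ⟨n, rfl⟩ : ∃ i, n = i + 1 := ⟨n - 1, by omega⟩
  have h1 : ((n + 1 : ℕ) : ℚ) ≠ 0 := by positivity
  -- Downward induction on `j`, starting from the single term `j = n + 1`.
  induction hd : n + 1 - j generalizing j with
  | zero =>
    obtain rfl : j = n + 1 := by omega
    simp only [Icc_self, sum_singleton]
    field_simp
  | succ d ih =>
    obtain ⟨j, rfl⟩ : ∃ i, j = i + 1 := ⟨j - 1, by omega⟩
    rw [← insert_Icc_succ_left_eq_Icc hjn, sum_insert (by simp), Nat.succ_eq_succ,
      Nat.succ_eq_add_one,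
      ih (by omega) (by omega) (by omega)]
    have a1 : ((n + 1).choose (j + 1) : ℚ) * ((j + 1 : ℕ) : ℚ) = ((n + 1 : ℕ) : ℚ) * n.choose j := by
      exact_mod_cast (Nat.add_one_mul_choose_eq n j).symm
    have a2 : ((n + 1).choose (j + 2) : ℚ) * ((j + 2 : ℕ) : ℚ) =
        ((n + 1 : ℕ) : ℚ) * n.choose (j + 1) := by
      exact_mod_cast (Nat.add_one_mul_choose_eq n (j + 1)).symm
    have a3 : ((n + 1).choose (j + 1) : ℚ) = n.choose j + n.choose (j + 1) := by
      exact_mod_cast Nat.choose_succ_succ n j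
    rw [a3] at a1 ⊢
    simp only [Nat.add_sub_cancel, mul_assoc]
    simp only [add_assoc, Nat.reduceAdd, a2]
    simp only [pow_succ]
    field_simp
    push_cast at a1 ⊢
    linear_combination -a1

/-- This supplies the second factor `1/k` at the entry `2`, and is where the inner partial sum
originates. -/
theorem inv_mul_binomTransform (f : ℕ → ℚ) (n : ℕ) :
    (n : ℚ)⁻¹ * binomTransform f n =
      binomTransform (fun k => ∑ j ∈ Icc 1 k, (j : ℚ)⁻¹ * f j) n := by
  simp only [binomTransform, mul_sum]
  rw [sum_comm' (t' := Icc 1 n) (s' := fun k => Icc k n) (by simp; omega)]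
  refine sum_congr rfl fun j hj => ?_
  have hj := mem_Icc.1 hj
  rw [← sum_mul, sum_Icc_neg_one_pow_choose hj.1 hj.2]
  have : (j : ℚ) ≠ 0 := by norm_cast; omega
  field_simp

theorem intervalSum_Icc_replicate_one (a : ℕ) {n : ℕ} (hn : 1 ≤ n) :
    intervalSum Icc 1 n (List.replicate a 1) = binomTransform (fun k => ((k : ℚ)⁻¹) ^ a) n := by
  induction a generalizing n with
  | zero => simp [intervalSum, binomTransform_one hn]
  | succ a ih =>
    rw [List.replicate_succ', intervalSum_Icc_append_singleton]
    simp only [pow_succ', pow_zero, mul_one]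
    rw [← sum_inv_mul_binomTransform]
    exact sum_congr rfl fun k hk => by rw [ih (mem_Icc.1 hk).1]

theorem intervalSum_Icc_onesTwoOnes (a b n : ℕ) :
    intervalSum Icc 1 n (onesTwoOnes a b) =
      binomTransform (fun k => ((k : ℚ)⁻¹) ^ (b + 1) * ∑ j ∈ Icc 1 k, ((j : ℚ)⁻¹) ^ (a + 1)) n := by
  induction b generalizing n with
  | zero =>
    rw [onesTwoOnes, List.replicate_zero, intervalSum_Icc_append_singleton]
    simp only [zero_add, pow_one]
    rw [← sum_inv_mul_binomTransform]
    refine sum_congr rfl fun k hk => ?_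
    simp only [pow_succ' _ a]
    rw [← inv_mul_binomTransform, intervalSum_Icc_replicate_one a (mem_Icc.1 hk).1]
    ring
  | succ b ih =>
    have : onesTwoOnes a (b + 1) = onesTwoOnes a b ++ [1] := by
      simp [onesTwoOnes, List.replicate_succ']
    rw [this, intervalSum_Icc_append_singleton]
    simp only [pow_succ' _ (b + 1), pow_one, mul_assoc]
    rw [← sum_inv_mul_binomTransform]
    exact sum_congr rfl fun k hk => by rw [ih]

/-! ### Arithmetic of `p`-integral rationals. -/

section Congruences

/-- The rational numbers `p ^ m * z` with `z` a `p`-integral rational number. -/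
def primePowMultiples (p : ℕ) [hp : Fact p.Prime] (m : ℕ) : AddSubgroup ℚ where
  carrier := {x | ∃ u v : ℤ, ¬ (p : ℤ) ∣ v ∧ x = (p : ℚ) ^ m * ((u : ℚ) / (v : ℚ))}
  zero_mem' := ⟨0, 1, fun h => hp.out.one_lt.ne'
    (by exact_mod_cast Int.eq_one_of_dvd_one (by positivity) h), by simp⟩
  neg_mem' := by
    rintro x ⟨u, v, hv, rfl⟩
    exact ⟨-u, v, hv, by push_cast; ring⟩
  add_mem' := by
    rintro x y ⟨u, v, hv, rfl⟩ ⟨u', v', hv', rfl⟩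
    refine ⟨u * v' + u' * v, v * v', fun h => ?_, ?_⟩
    · rcases (Nat.prime_iff_prime_int.1 hp.out).dvd_or_dvd h with h | h <;> contradiction
    · have h1 : (v : ℚ) ≠ 0 := by rintro h; apply hv; simp [Int.cast_eq_zero.1 h]
      have h2 : (v' : ℚ) ≠ 0 := by rintro h; apply hv'; simp [Int.cast_eq_zero.1 h]
      push_cast
      field_simp

variable {p : ℕ} [hp : Fact p.Prime]

theorem ratCongr_iff_sub_mem {m : ℕ} {x y : ℚ} : RatCongr p m x y ↔ x - y ∈ primePowMultiples p m :=
  Iff.rfl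

theorem mul_mem_primePowMultiples {m n : ℕ} {x y : ℚ} (hx : x ∈ primePowMultiples p m)
    (hy : y ∈ primePowMultiples p n) : x * y ∈ primePowMultiples p (m + n) := by
  obtain ⟨u, v, hv, rfl⟩ := hx
  obtain ⟨u', v', hv', rfl⟩ := hy
  refine ⟨u * u', v * v', fun h => ?_, ?_⟩
  · rcases (Nat.prime_iff_prime_int.1 hp.out).dvd_or_dvd h with h | h <;> contradiction
  · push_cast
    rw [pow_add, mul_div_mul_comm]
    ring

theorem mul_mem_left_primePowMultiples {m : ℕ} {x y : ℚ} (hx : x ∈ primePowMultiples p 0)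
    (hy : y ∈ primePowMultiples p m) : x * y ∈ primePowMultiples p m := by
  simpa using mul_mem_primePowMultiples hx hy

theorem mul_mem_right_primePowMultiples {m : ℕ} {x y : ℚ} (hx : x ∈ primePowMultiples p m)
    (hy : y ∈ primePowMultiples p 0) : x * y ∈ primePowMultiples p m :=
  mul_mem_primePowMultiples hx hy

theorem intCast_mem_primePowMultiples_zero (z : ℤ) : (z : ℚ) ∈ primePowMultiples p 0 :=
  ⟨z, 1, fun h => hp.out.one_lt.ne' (by exact_mod_cast Int.eq_one_of_dvd_one (by positivity) h),
    by simp⟩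

theorem natCast_mem_primePowMultiples_zero (z : ℕ) : (z : ℚ) ∈ primePowMultiples p 0 := by
  exact_mod_cast intCast_mem_primePowMultiples_zero (z : ℤ)

theorem one_mem_primePowMultiples_zero : (1 : ℚ) ∈ primePowMultiples p 0 := by
  exact_mod_cast natCast_mem_primePowMultiples_zero 1

theorem intCast_mul_mem_primePowMultiples (z : ℤ) (m : ℕ) :
    (p : ℚ) ^ m * z ∈ primePowMultiples p m := by
  refine ⟨z, 1, fun h => hp.out.one_lt.ne' ?_, by simp⟩
  exact_mod_cast Int.eq_one_of_dvd_one (by positivity) h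

theorem prime_mem_primePowMultiples_one : (p : ℚ) ∈ primePowMultiples p 1 := by
  simpa using intCast_mul_mem_primePowMultiples (p := p) 1 1

theorem prime_mul_mem_primePowMultiples {m : ℕ} {x : ℚ} (hx : x ∈ primePowMultiples p m) :
    (p : ℚ) * x ∈ primePowMultiples p (m + 1) := by
  rw [add_comm]
  exact mul_mem_primePowMultiples prime_mem_primePowMultiples_one hx

theorem inv_natCast_mem_primePowMultiples_zero {k : ℕ} (hk : 0 < k) (hkp : k < p) :
    (k : ℚ)⁻¹ ∈ primePowMultiples p 0 := by
  refine ⟨1, k, fun h => ?_, by simp⟩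
  exact Nat.not_dvd_of_pos_of_lt hk hkp (by exact_mod_cast h)

theorem primePowMultiples_antitone {m n : ℕ} (h : m ≤ n) :
    primePowMultiples p n ≤ primePowMultiples p m := by
  rintro x ⟨u, v, hv, rfl⟩
  refine ⟨p ^ (n - m) * u, v, hv, ?_⟩
  push_cast
  rw [← Nat.sub_add_cancel h, pow_add]
  simp
  ring

theorem pow_mem_primePowMultiples_zero {x : ℚ} (hx : x ∈ primePowMultiples p 0) (n : ℕ) :
    x ^ n ∈ primePowMultiples p 0 := by
  induction n with
  | zero => simpa using one_mem_primePowMultiples_zero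
  | succ n ih => exact pow_succ x n ▸ mul_mem_primePowMultiples ih hx

theorem neg_one_pow_mem_primePowMultiples_zero (n : ℕ) : (-1 : ℚ) ^ n ∈ primePowMultiples p 0 :=
  pow_mem_primePowMultiples_zero (neg_mem one_mem_primePowMultiples_zero) n

theorem mem_primePowMultiples_of_natCast_mul_mem {k m : ℕ} {x : ℚ} (hk : 0 < k) (hkp : k < p)
    (h : (k : ℚ) * x ∈ primePowMultiples p m) : x ∈ primePowMultiples p m := by
  have := mul_mem_left_primePowMultiples (inv_natCast_mem_primePowMultiples_zero hk hkp) h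
  rwa [inv_mul_cancel_left₀ (by positivity)] at this

theorem inv_pow_mem_primePowMultiples_zero {k : ℕ} (hk : 0 < k) (hkp : k < p) (s : ℕ) :
    ((k : ℚ)⁻¹) ^ s ∈ primePowMultiples p 0 :=
  pow_mem_primePowMultiples_zero (inv_natCast_mem_primePowMultiples_zero hk hkp) s

/-- The recursion for `B_i` only divides by `i + 1 < p`, so no denominator acquires a factor `p`. -/
theorem bernoulli_mem_primePowMultiples_zero {i : ℕ} (hi : i + 1 < p) :
    bernoulli i ∈ primePowMultiples p 0 := by
  induction i using Nat.strong_induction_on with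
  | _ i ih =>
    have h := sum_bernoulli (i + 1)
    rw [sum_range_succ, Nat.choose_succ_self_right] at h
    refine mem_primePowMultiples_of_natCast_mul_mem (Nat.succ_pos i) hi ?_
    rw [Nat.succ_eq_add_one, eq_sub_of_add_eq' h]
    refine sub_mem ?_ (sum_mem fun j hj => ?_)
    · split_ifs
      · exact one_mem_primePowMultiples_zero
      · exact zero_mem _
    · have := mem_range.1 hj
      exact mul_mem_left_primePowMultiples (natCast_mem_primePowMultiples_zero _)
        (ih j this (by omega))

theorem bernoulli'_mem_primePowMultiples_zero {i : ℕ} (hi : i + 1 < p) :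
    bernoulli' i ∈ primePowMultiples p 0 := by
  rw [bernoulli'_eq_bernoulli]
  exact mul_mem_left_primePowMultiples (neg_one_pow_mem_primePowMultiples_zero _)
    (bernoulli_mem_primePowMultiples_zero hi)

/-! ### Power sums and double sums modulo `p`. -/

theorem sum_pow_mem_primePowMultiples_one {e : ℕ} (he : 0 < e) (hep : e + 1 < p) :
    ∑ k ∈ Icc 1 (p - 1), (k : ℚ) ^ e ∈ primePowMultiples p 1 := by
  have h : ∑ k ∈ Icc 1 (p - 1), (k : ℚ) ^ e = ∑ k ∈ range p, (k : ℚ) ^ e := by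
    rw [range_eq_Ico, sum_eq_sum_Ico_succ_bot hp.out.pos,
      show Icc 1 (p - 1) = Ico (0 + 1) p by ext; simp; omega]
    simp [he.ne']
  rw [h, sum_range_pow]
  refine sum_mem fun i hi => ?_
  have hi := mem_range.1 hi
  rw [div_eq_mul_inv]
  refine mul_mem_right_primePowMultiples (mul_mem_left_primePowMultiples
    (mul_mem_left_primePowMultiples (bernoulli_mem_primePowMultiples_zero (by omega))
    (natCast_mem_primePowMultiples_zero _)) ?_) ?_
  · refine primePowMultiples_antitone (show 1 ≤ e + 1 - i by omega) ?_
    simpa using intCast_mul_mem_primePowMultiples (p := p) 1 (e + 1 - i)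
  · exact_mod_cast inv_natCast_mem_primePowMultiples_zero (Nat.succ_pos e) hep

theorem pow_card_sub_one_sub_one_mem {k : ℕ} (hk : 0 < k) (hkp : k < p) :
    (k : ℚ) ^ (p - 1) - 1 ∈ primePowMultiples p 1 := by
  have h : (p : ℤ) ∣ (k : ℤ) ^ (p - 1) - 1 := by
    rw [← ZMod.intCast_zmod_eq_zero_iff_dvd]
    push_cast
    rw [ZMod.pow_card_sub_one_eq_one, sub_self]
    rw [Ne, ZMod.natCast_eq_zero_iff]
    exact Nat.not_dvd_of_pos_of_lt hk hkp
  obtain ⟨z, hz⟩ := h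
  have : (k : ℚ) ^ (p - 1) - 1 = (p : ℚ) ^ 1 * z := by rw [pow_one]; exact_mod_cast hz
  rw [this]
  exact intCast_mul_mem_primePowMultiples z 1

theorem inv_pow_sub_pow_mem {k s : ℕ} (hk : 0 < k) (hkp : k < p) (hs : s ≤ p - 1) :
    ((k : ℚ)⁻¹) ^ s - (k : ℚ) ^ (p - 1 - s) ∈ primePowMultiples p 1 := by
  have h : ((k : ℚ)⁻¹) ^ s - (k : ℚ) ^ (p - 1 - s) =
      -(((k : ℚ)⁻¹) ^ s * ((k : ℚ) ^ (p - 1) - 1)) := by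
    rw [← Nat.sub_add_cancel hs, pow_add, Nat.add_sub_cancel]
    have : (k : ℚ) ≠ 0 := by positivity
    rw [inv_pow]
    field_simp
    ring
  rw [h]
  exact neg_mem (mul_mem_left_primePowMultiples (inv_pow_mem_primePowMultiples_zero hk hkp s)
    (pow_card_sub_one_sub_one_mem hk hkp))

/-- The generalized harmonic number `∑_{j=1}^n j^{-s}`. -/
def harmonicPow (n s : ℕ) : ℚ := ∑ j ∈ Icc 1 n, ((j : ℚ)⁻¹) ^ s

/-- The double star harmonic sum `∑_{1 ≤ j ≤ k ≤ n} j^{-s} k^{-t}`. -/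
def doubleHarmonic (n s t : ℕ) : ℚ := ∑ k ∈ Icc 1 n, ((k : ℚ)⁻¹) ^ t * harmonicPow k s

theorem pos_and_lt_of_mem_Icc {k : ℕ} (h : k ∈ Icc 1 (p - 1)) : 0 < k ∧ k < p := by
  have := hp.out.pos
  simp at h
  omega

theorem harmonicPow_mem_primePowMultiples_zero {n : ℕ} (hn : n < p) (s : ℕ) :
    harmonicPow n s ∈ primePowMultiples p 0 :=
  sum_mem fun j hj => inv_pow_mem_primePowMultiples_zero (by simp at hj; omega)
    (by simp at hj; omega) s

theorem harmonicPow_mem_primePowMultiples_one {s : ℕ} (hs : 0 < s) (hsp : s + 1 < p) :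
    harmonicPow (p - 1) s ∈ primePowMultiples p 1 := by
  rw [harmonicPow, ← sub_add_cancel (∑ j ∈ Icc 1 (p - 1), ((j : ℚ)⁻¹) ^ s)
    (∑ j ∈ Icc 1 (p - 1), (j : ℚ) ^ (p - 1 - s)), ← sum_sub_distrib]
  refine add_mem (sum_mem fun j hj => ?_) (sum_pow_mem_primePowMultiples_one (by omega) (by omega))
  have := pos_and_lt_of_mem_Icc hj
  exact inv_pow_sub_pow_mem this.1 this.2 (by omega)

/-- Each factor `p - 1 - s - i` of the numerator is `-(s + 1 + i)` mod `p`. -/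
theorem choose_sub_mem_primePowMultiples_one {s r : ℕ} (h : s + r < p) :
    ((p - 1 - s).choose r : ℚ) - (-1) ^ r * ((s + r).choose r : ℚ) ∈ primePowMultiples p 1 := by
  induction r with
  | zero => simp
  | succ r ih =>
    refine mem_primePowMultiples_of_natCast_mul_mem (Nat.succ_pos r) (by omega) ?_
    have h1 : ((p - 1 - s).choose (r + 1) : ℚ) * ((r : ℚ) + 1) =
        (p - 1 - s).choose r * ((p : ℚ) - 1 - s - r) := by
      have := Nat.choose_succ_right_eq (p - 1 - s) r
      have e : ((p - 1 - s - r : ℕ) : ℚ) = (p : ℚ) - 1 - s - r := by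
        rw [show p - 1 - s - r = p - (1 + s + r) by omega, Nat.cast_sub (by omega)]
        push_cast
        ring
      rw [← e]
      exact_mod_cast this
    have h2 : ((s + (r + 1)).choose (r + 1) : ℚ) * ((r : ℚ) + 1) =
        ((s : ℚ) + r + 1) * (s + r).choose r := by
      exact_mod_cast (Nat.add_one_mul_choose_eq (s + r) r).symm
    have : ((r.succ : ℕ) : ℚ) * (((p - 1 - s).choose (r + 1) : ℚ) -
          (-1) ^ (r + 1) * ((s + (r + 1)).choose (r + 1) : ℚ)) =
        p * ((p - 1 - s).choose r : ℚ) - ((1 + s + r : ℕ) : ℚ) *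
          (((p - 1 - s).choose r : ℚ) - (-1) ^ r * ((s + r).choose r : ℚ)) := by
      push_cast
      linear_combination h1 - (-1) ^ (r + 1) * h2
    rw [this]
    exact sub_mem (prime_mul_mem_primePowMultiples (natCast_mem_primePowMultiples_zero _))
      (mul_mem_left_primePowMultiples (natCast_mem_primePowMultiples_zero _) (ih (by omega)))

theorem sum_inv_pow_mul_pow_mem {t e : ℕ} (hte : t ≠ e) (h1 : t < e + (p - 1))
    (h2 : e < t + (p - 1)) :
    ∑ k ∈ Icc 1 (p - 1), ((k : ℚ)⁻¹) ^ t * (k : ℚ) ^ e ∈ primePowMultiples p 1 := by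
  rcases lt_or_gt_of_ne hte with h | h
  · obtain ⟨d, rfl⟩ := Nat.exists_eq_add_of_lt h
    rw [sum_congr rfl (g := fun k : ℕ => (k : ℚ) ^ (d + 1))]
    · exact sum_pow_mem_primePowMultiples_one (by omega) (by omega)
    · intro k hk
      have : (k : ℚ) ≠ 0 := by have := (pos_and_lt_of_mem_Icc hk).1; positivity
      simp only [inv_pow]
      field_simp
      ring
  · obtain ⟨d, rfl⟩ := Nat.exists_eq_add_of_lt h
    rw [sum_congr rfl (g := fun k : ℕ => ((k : ℚ)⁻¹) ^ (d + 1))]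
    · exact harmonicPow_mem_primePowMultiples_one (by omega) (by omega)
    · intro k hk
      have : (k : ℚ) ≠ 0 := by have := (pos_and_lt_of_mem_Icc hk).1; positivity
      simp only [inv_pow]
      field_simp
      ring

/-- By Fermat `j^{-s} ≡ j^{p-1-s}`, and Faulhaber makes the inner sum a polynomial in `k`. Summed
against `k^{-t}`, every monomial vanishes mod `p` except `k^t`, whose contribution `p - 1 ≡ -1`
isolates one Bernoulli number. -/
theorem doubleHarmonic_sub_mem {s t : ℕ} (hs : 0 < s) (ht : 0 < t) (hst : s + t + 1 < p) :
    doubleHarmonic (p - 1) s t -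
      (-1) ^ t * ((s + t).choose t : ℚ) / ((s : ℚ) + t) * bernoulli (p - (s + t)) ∈
      primePowMultiples p 1 := by
  obtain ⟨t, rfl⟩ : ∃ i, t = i + 1 := ⟨t - 1, by omega⟩
  obtain ⟨q, hq⟩ : ∃ q, p = q + 1 + s := ⟨p - 1 - s, by omega⟩
  -- The index for which the Faulhaber exponent `q + 1 - i₀` equals `t + 1`.
  set i₀ := p - (s + (t + 1)) with hi₀
  set c : ℕ → ℚ := fun i => bernoulli' i * ((q + 1).choose i : ℚ) * ((q + 1 : ℕ) : ℚ)⁻¹ with hc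
  have hci : ∀ i ∈ range (q + 1), c i ∈ primePowMultiples p 0 := fun i hi =>
    mul_mem_left_primePowMultiples (mul_mem_left_primePowMultiples
      (bernoulli'_mem_primePowMultiples_zero (by have := mem_range.1 hi; omega))
      (natCast_mem_primePowMultiples_zero _))
      (inv_natCast_mem_primePowMultiples_zero (by omega) (by omega))
  have h1 : doubleHarmonic (p - 1) s (t + 1) - ∑ k ∈ Icc 1 (p - 1), ((k : ℚ)⁻¹) ^ (t + 1) *
      ∑ j ∈ Ico 1 (k + 1), (j : ℚ) ^ q ∈ primePowMultiples p 1 := by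
    rw [doubleHarmonic, ← sum_sub_distrib]
    refine sum_mem fun k hk => ?_
    have hk := pos_and_lt_of_mem_Icc hk
    rw [← mul_sub, harmonicPow, show Ico 1 (k + 1) = Icc 1 k by ext; simp,
      ← sum_sub_distrib]
    refine mul_mem_left_primePowMultiples (inv_pow_mem_primePowMultiples_zero hk.1 hk.2 _)
      (sum_mem fun j hj => ?_)
    rw [show q = p - 1 - s by omega]
    simp at hj
    exact inv_pow_sub_pow_mem (by omega) (by omega) (by omega)
  have h2 : ∑ k ∈ Icc 1 (p - 1), ((k : ℚ)⁻¹) ^ (t + 1) * ∑ j ∈ Ico 1 (k + 1), (j : ℚ) ^ q =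
      ∑ i ∈ range (q + 1), c i *
        ∑ k ∈ Icc 1 (p - 1), ((k : ℚ)⁻¹) ^ (t + 1) * (k : ℚ) ^ (q + 1 - i) := by
    simp only [sum_Ico_pow, mul_sum]
    rw [sum_comm]
    refine sum_congr rfl fun i _ => sum_congr rfl fun k _ => ?_
    simp only [hc]
    push_cast
    ring
  have hmem : i₀ ∈ range (q + 1) := by simp; omega
  rw [h2, ← add_sum_erase _ _ hmem] at h1
  have h3 : ∑ i ∈ (range (q + 1)).erase i₀, c i *
        ∑ k ∈ Icc 1 (p - 1), ((k : ℚ)⁻¹) ^ (t + 1) * (k : ℚ) ^ (q + 1 - i) ∈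
        primePowMultiples p 1 := by
    refine sum_mem fun i hi => ?_
    have hi1 := mem_range.1 (mem_of_mem_erase hi)
    have hi2 := ne_of_mem_erase hi
    exact mul_mem_left_primePowMultiples (hci i (mem_of_mem_erase hi))
      (sum_inv_pow_mul_pow_mem (by omega) (by omega) (by omega))
  have h4 : ∑ k ∈ Icc 1 (p - 1), ((k : ℚ)⁻¹) ^ (t + 1) * (k : ℚ) ^ (q + 1 - i₀) = p - 1 := by
    rw [sum_congr rfl (g := fun _ => 1), sum_const, Nat.card_Icc]
    · simp [Nat.cast_sub hp.out.one_le]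
    · intro k hk
      have : (k : ℚ) ≠ 0 := by have := (pos_and_lt_of_mem_Icc hk).1; positivity
      rw [show q + 1 - i₀ = t + 1 by omega, inv_pow]
      field_simp
  rw [h4] at h1
  have hb : bernoulli' i₀ = bernoulli i₀ :=
    (bernoulli_eq_bernoulli'_of_ne_one (by omega)).symm
  have hbm := bernoulli_mem_primePowMultiples_zero (p := p) (i := i₀) (by omega)
  have e1 : ((q + 1).choose i₀ : ℚ) * ((t : ℚ) + 1) = ((q : ℚ) + 1) * q.choose t := by
    rw [show (q + 1).choose i₀ = (q + 1).choose (t + 1) from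
      Nat.choose_symm_of_eq_add (by omega)]
    exact_mod_cast (Nat.add_one_mul_choose_eq q t).symm
  have e2 : ((s + (t + 1)).choose (t + 1) : ℚ) * ((t : ℚ) + 1) =
      ((s : ℚ) + t + 1) * (s + t).choose t := by
    exact_mod_cast (Nat.add_one_mul_choose_eq (s + t) t).symm
  have h5 := choose_sub_mem_primePowMultiples_one (p := p) (s := s) (r := t) (by omega)
  rw [show p - 1 - s = q by omega] at h5
  have n1 : (q : ℚ) + 1 ≠ 0 := by positivity
  have n2 : (t : ℚ) + 1 ≠ 0 := by positivity
  have n3 : (s : ℚ) + t + 1 ≠ 0 := by positivity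
  have e1' : c i₀ = bernoulli i₀ * ((t + 1 : ℕ) : ℚ)⁻¹ * q.choose t := by
    simp only [hc, hb]
    push_cast
    field_simp
    linear_combination bernoulli i₀ * e1
  have e2' : (-1) ^ (t + 1) * ((s + (t + 1)).choose (t + 1) : ℚ) / ((s : ℚ) + (t + 1 : ℕ)) *
      bernoulli i₀ = - (bernoulli i₀ * ((t + 1 : ℕ) : ℚ)⁻¹ * ((-1) ^ t * (s + t).choose t)) := by
    push_cast
    rw [← add_assoc]
    field_simp
    linear_combination (-1) ^ (t + 1) * bernoulli i₀ * e2
  have hbt : bernoulli i₀ * ((t + 1 : ℕ) : ℚ)⁻¹ ∈ primePowMultiples p 0 :=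
    mul_mem_left_primePowMultiples hbm (inv_natCast_mem_primePowMultiples_zero (by omega) (by omega))
  have h6 := add_mem (sub_mem (add_mem h1 h3) (mul_mem_left_primePowMultiples hbt h5))
    (prime_mul_mem_primePowMultiples (hci i₀ hmem))
  convert h6 using 1
  rw [e2', e1']
  ring

/-! ### Binomial transforms at `p - 1` modulo `p²`. -/

theorem neg_one_pow_mul_choose_sub_mem {k : ℕ} (hk : k < p) :
    (-1 : ℚ) ^ k * ((p - 1).choose k : ℚ) - (1 - p * harmonicPow k 1) ∈ primePowMultiples p 2 := by
  induction k with
  | zero => simp [harmonicPow]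
  | succ k ih =>
    have h1 : ((p - 1).choose (k + 1) : ℚ) * ((k : ℚ) + 1) =
        (p - 1).choose k * ((p : ℚ) - 1 - k) := by
      have := Nat.choose_succ_right_eq (p - 1) k
      have e : ((p - 1 - k : ℕ) : ℚ) = (p : ℚ) - 1 - k := by
        rw [show p - 1 - k = p - (1 + k) by omega, Nat.cast_sub (by omega)]
        push_cast
        ring
      rw [← e]
      exact_mod_cast this
    have h2 : harmonicPow (k + 1) 1 = harmonicPow k 1 + ((k + 1 : ℕ) : ℚ)⁻¹ := by
      simp [harmonicPow, sum_Icc_succ_top]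
    have hinv := inv_natCast_mem_primePowMultiples_zero (Nat.succ_pos k) hk
    have hp1 := prime_mul_mem_primePowMultiples hinv
    have h3 : (-1 : ℚ) ^ (k + 1) * ((p - 1).choose (k + 1) : ℚ) =
        (-1) ^ k * ((p - 1).choose k : ℚ) * (1 - p * ((k + 1 : ℕ) : ℚ)⁻¹) := by
      have : (k : ℚ) + 1 ≠ 0 := by positivity
      push_cast
      field_simp
      linear_combination (-1) ^ (k + 1) * h1
    -- The signed binomial is the product of the factors `1 - p/i` over `i ≤ k + 1`; the last
    -- summand here is the `p²` error of multiplying in one more factor.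
    have key : (-1 : ℚ) ^ (k + 1) * ((p - 1).choose (k + 1) : ℚ) -
          (1 - p * harmonicPow (k + 1) 1) =
        (1 - p * ((k + 1 : ℕ) : ℚ)⁻¹) *
          ((-1) ^ k * ((p - 1).choose k : ℚ) - (1 - p * harmonicPow k 1)) +
        p * ((k + 1 : ℕ) : ℚ)⁻¹ * (p * harmonicPow k 1) := by
      rw [h3, h2]
      ring
    rw [key]
    refine add_mem (mul_mem_left_primePowMultiples (sub_mem one_mem_primePowMultiples_zero
      (primePowMultiples_antitone (Nat.zero_le 1) hp1)) (ih (by omega))) ?_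
    exact mul_mem_primePowMultiples hp1 (prime_mul_mem_primePowMultiples
      (harmonicPow_mem_primePowMultiples_zero (by omega) 1))

theorem binomTransform_sub_mem {f : ℕ → ℚ}
    (hf : ∀ k, 0 < k → k < p → f k ∈ primePowMultiples p 0) :
    binomTransform f (p - 1) -
      (p * ∑ k ∈ Icc 1 (p - 1), harmonicPow k 1 * f k - ∑ k ∈ Icc 1 (p - 1), f k) ∈
      primePowMultiples p 2 := by
  rw [binomTransform, mul_sum, ← sum_sub_distrib, ← sum_sub_distrib]
  refine sum_mem fun k hk => ?_
  obtain ⟨hk, hkp⟩ := pos_and_lt_of_mem_Icc hk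
  obtain ⟨k, rfl⟩ : ∃ i, k = i + 1 := ⟨k - 1, by omega⟩
  have := mul_mem_right_primePowMultiples (neg_mem (neg_one_pow_mul_choose_sub_mem hkp)) (hf _ hk hkp)
  convert this using 1
  rw [Nat.add_sub_cancel]
  ring

theorem binomTransform_add_mem_one {f : ℕ → ℚ}
    (hf : ∀ k, 0 < k → k < p → f k ∈ primePowMultiples p 0) :
    binomTransform f (p - 1) + ∑ k ∈ Icc 1 (p - 1), f k ∈ primePowMultiples p 1 := by
  have h1 := primePowMultiples_antitone one_le_two (binomTransform_sub_mem hf)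
  have h2 : (p : ℚ) * ∑ k ∈ Icc 1 (p - 1), harmonicPow k 1 * f k ∈ primePowMultiples p 1 :=
    prime_mul_mem_primePowMultiples (sum_mem fun k hk => by
      have := pos_and_lt_of_mem_Icc hk
      exact mul_mem_left_primePowMultiples (harmonicPow_mem_primePowMultiples_zero this.2 1)
        (hf k this.1 this.2))
  convert add_mem h1 h2 using 1
  ring

/-! ### The reflection `k ↦ p - k`. -/

theorem inv_prime_sub_pow_sub_mem {k : ℕ} (hk : 0 < k) (hkp : k < p) (t : ℕ) :
    (((p - k : ℕ) : ℚ)⁻¹) ^ t - (-1) ^ t * (((k : ℚ)⁻¹) ^ t + t * (p * ((k : ℚ)⁻¹) ^ (t + 1))) ∈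
      primePowMultiples p 2 := by
  have hx := inv_natCast_mem_primePowMultiples_zero hk hkp
  have hy := inv_natCast_mem_primePowMultiples_zero (p := p) (k := p - k) (by omega) (by omega)
  have hpp : (p : ℚ) * p ∈ primePowMultiples p 2 :=
    prime_mul_mem_primePowMultiples prime_mem_primePowMultiples_one
  induction t with
  | zero => simp
  | succ t ih =>
    have h0 : (((p - k : ℕ) : ℚ)⁻¹) = -((k : ℚ)⁻¹ + p * ((k : ℚ)⁻¹) ^ 2) +
        p * p * (((k : ℚ)⁻¹) ^ 2 * ((p - k : ℕ) : ℚ)⁻¹) := by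
      have h1 : (k : ℚ) ≠ 0 := by positivity
      have h2 : ((p : ℚ) - k) ≠ 0 := sub_ne_zero.2 (by exact_mod_cast hkp.ne')
      rw [Nat.cast_sub hkp.le]
      field_simp
      ring
    set y := ((p - k : ℕ) : ℚ)⁻¹
    set x := (k : ℚ)⁻¹
    have key : y ^ (t + 1) -
        (-1) ^ (t + 1) * (x ^ (t + 1) + (t + 1 : ℕ) * (p * x ^ (t + 1 + 1))) =
        (y ^ t - (-1) ^ t * (x ^ t + t * (p * x ^ (t + 1)))) * y +
        p * p * ((-1) ^ t * (x ^ 2 * y * (x ^ t + t * (p * x ^ (t + 1))) - t * x ^ (t + 3))) := by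
      push_cast
      linear_combination ((-1) ^ t * (x ^ t + t * (p * x ^ (t + 1)))) * h0
    have hpz := primePowMultiples_antitone (Nat.zero_le 1) (prime_mem_primePowMultiples_one (p := p))
    rw [key]
    refine add_mem (mul_mem_right_primePowMultiples ih hy) (mul_mem_right_primePowMultiples hpp
      (mul_mem_left_primePowMultiples (neg_one_pow_mem_primePowMultiples_zero t) (sub_mem
        (mul_mem_left_primePowMultiples (mul_mem_left_primePowMultiples
          (pow_mem_primePowMultiples_zero hx _) hy) (add_mem (pow_mem_primePowMultiples_zero hx _)
          (mul_mem_left_primePowMultiples (natCast_mem_primePowMultiples_zero _)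
            (mul_mem_left_primePowMultiples hpz (pow_mem_primePowMultiples_zero hx _)))))
        (mul_mem_left_primePowMultiples (natCast_mem_primePowMultiples_zero _)
          (pow_mem_primePowMultiples_zero hx _)))))

theorem inv_prime_sub_pow_sub_mem_one {k : ℕ} (hk : 0 < k) (hkp : k < p) (t : ℕ) :
    (((p - k : ℕ) : ℚ)⁻¹) ^ t - (-1) ^ t * ((k : ℚ)⁻¹) ^ t ∈ primePowMultiples p 1 := by
  have h1 := primePowMultiples_antitone one_le_two (inv_prime_sub_pow_sub_mem hk hkp t)
  have h2 := prime_mul_mem_primePowMultiples (mul_mem_left_primePowMultiples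
    (mul_mem_left_primePowMultiples (neg_one_pow_mem_primePowMultiples_zero (p := p) t)
    (natCast_mem_primePowMultiples_zero t)) (inv_pow_mem_primePowMultiples_zero hk hkp (t + 1)))
  convert add_mem h1 h2 using 1
  ring

theorem sum_Icc_sub_reflect (f : ℕ → ℚ) {k : ℕ} (hk : k ≤ p) :
    ∑ j ∈ Icc 1 (k - 1), f (p - j) = ∑ j ∈ Icc (p - k + 1) (p - 1), f j := by
  have := hp.out.pos
  refine sum_nbij' (fun j => p - j) (fun j => p - j) ?_ ?_ ?_ ?_ ?_
  all_goals simp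
  all_goals intro j h1 h2
  all_goals omega

theorem sum_Icc_prime_sub (f : ℕ → ℚ) :
    ∑ j ∈ Icc 1 (p - 1), f (p - j) = ∑ j ∈ Icc 1 (p - 1), f j := by
  simpa using sum_Icc_sub_reflect (p := p) f le_rfl

theorem sum_sum_Icc_sub (n : ℕ) (f : ℕ → ℕ → ℚ) :
    ∑ k ∈ Icc 1 (n - 1), ∑ j ∈ Icc 1 k, f j k =
      ∑ k ∈ Icc 1 (n - 1), ∑ j ∈ Icc 1 k, f (n - k) (n - j) := by
  rw [sum_sigma', sum_sigma']
  refine sum_nbij' (fun x => ⟨n - x.2, n - x.1⟩) (fun x => ⟨n - x.2, n - x.1⟩) ?_ ?_ ?_ ?_ ?_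
  all_goals rintro ⟨k, j⟩ h
  all_goals simp only [mem_sigma, mem_Icc] at h ⊢
  · omega
  · omega
  · simp only [Sigma.mk.injEq, heq_eq_eq]; omega
  · simp only [Sigma.mk.injEq, heq_eq_eq]; omega
  · congr 1 <;> omega

theorem doubleHarmonic_add_swap (n s t : ℕ) :
    doubleHarmonic n s t + doubleHarmonic n t s =
      harmonicPow n s * harmonicPow n t + harmonicPow n (s + t) := by
  induction n with
  | zero => simp [doubleHarmonic, harmonicPow]
  | succ n ih =>
    have h (s : ℕ) : harmonicPow (n + 1) s = harmonicPow n s + (((n + 1 : ℕ) : ℚ)⁻¹) ^ s := by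
      simp [harmonicPow, sum_Icc_succ_top]
    have h' (s t : ℕ) : doubleHarmonic (n + 1) s t = doubleHarmonic n s t +
        (((n + 1 : ℕ) : ℚ)⁻¹) ^ t * harmonicPow (n + 1) s := by
      simp [doubleHarmonic, sum_Icc_succ_top]
    simp only [h, h']
    rw [pow_add]
    linear_combination ih

/-- Reflecting both indices reverses their order and hence swaps the exponents; the first-order
terms in `p` give the correction, and even weight removes the sign. -/
theorem doubleHarmonic_swap_sub_mem {s t : ℕ} (hst : Even (s + t)) :
    doubleHarmonic (p - 1) t s - (doubleHarmonic (p - 1) s t +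
      p * (s * doubleHarmonic (p - 1) (s + 1) t + t * doubleHarmonic (p - 1) s (t + 1))) ∈
      primePowMultiples p 2 := by
  have e (s t : ℕ) : doubleHarmonic (p - 1) s t =
      ∑ k ∈ Icc 1 (p - 1), ∑ j ∈ Icc 1 k, ((k : ℚ)⁻¹) ^ t * ((j : ℚ)⁻¹) ^ s := by
    simp only [doubleHarmonic, harmonicPow, mul_sum]
  rw [e t s, sum_sum_Icc_sub]
  simp only [e, mul_sum, ← sum_add_distrib, ← sum_sub_distrib]
  refine sum_mem fun k hk => sum_mem fun j hj => ?_
  obtain ⟨hk, hkp⟩ := pos_and_lt_of_mem_Icc hk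
  obtain ⟨hj, hjp⟩ : 0 < j ∧ j < p := by simp at hj; omega
  have h1 := inv_prime_sub_pow_sub_mem hk hkp t
  have h2 := inv_prime_sub_pow_sub_mem hj hjp s
  have hxk := inv_natCast_mem_primePowMultiples_zero hk hkp
  have hxj := inv_natCast_mem_primePowMultiples_zero hj hjp
  have hyk := inv_natCast_mem_primePowMultiples_zero (p := p) (k := p - k) (by omega) (by omega)
  have hyj := inv_natCast_mem_primePowMultiples_zero (p := p) (k := p - j) (by omega) (by omega)
  set x := (k : ℚ)⁻¹
  set y := (j : ℚ)⁻¹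
  set x' := ((p - k : ℕ) : ℚ)⁻¹
  set y' := ((p - j : ℕ) : ℚ)⁻¹
  have hs : (-1 : ℚ) ^ s * (-1) ^ t = 1 := by rw [← pow_add, hst.neg_one_pow]
  have hpp : (p : ℚ) * p ∈ primePowMultiples p 2 :=
    prime_mul_mem_primePowMultiples prime_mem_primePowMultiples_one
  have hpz := primePowMultiples_antitone (Nat.zero_le 1) (prime_mem_primePowMultiples_one (p := p))
  have key : y' ^ s * x' ^ t - (x ^ t * y ^ s + (p * (s * (x ^ t * y ^ (s + 1))) +
      p * (t * (x ^ (t + 1) * y ^ s)))) =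
      (y' ^ s - (-1) ^ s * (y ^ s + s * (p * y ^ (s + 1)))) * x' ^ t +
      (x' ^ t - (-1) ^ t * (x ^ t + t * (p * x ^ (t + 1)))) *
        ((-1) ^ s * (y ^ s + s * (p * y ^ (s + 1)))) +
      p * p * (s * t * (x ^ (t + 1) * y ^ (s + 1))) := by
    linear_combination ((x ^ t + t * (p * x ^ (t + 1))) * (y ^ s + s * (p * y ^ (s + 1)))) * hs
  have key' := add_mem (add_mem
    (mul_mem_right_primePowMultiples h2 (pow_mem_primePowMultiples_zero hyk t))
    (mul_mem_right_primePowMultiples h1 (mul_mem_left_primePowMultiples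
      (neg_one_pow_mem_primePowMultiples_zero s) (add_mem (pow_mem_primePowMultiples_zero hxj s)
      (mul_mem_left_primePowMultiples (natCast_mem_primePowMultiples_zero s)
      (mul_mem_left_primePowMultiples hpz (pow_mem_primePowMultiples_zero hxj (s + 1))))))))
    (mul_mem_right_primePowMultiples hpp (mul_mem_left_primePowMultiples
      (mul_mem_left_primePowMultiples (natCast_mem_primePowMultiples_zero s)
      (natCast_mem_primePowMultiples_zero t)) (mul_mem_left_primePowMultiples
      (pow_mem_primePowMultiples_zero hxk (t + 1)) (pow_mem_primePowMultiples_zero hxj (s + 1)))))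
  rw [← key] at key'
  convert key' using 1
  ring

/-- Reflection is combined with the stuffle relation `doubleHarmonic_add_swap`, in which the product
of two power sums is divisible by `p²`. -/
theorem two_mul_doubleHarmonic_sub_mem {s t : ℕ} (hs : 0 < s) (ht : 0 < t) (hsp : s + 1 < p)
    (htp : t + 1 < p) (hst : Even (s + t)) :
    2 * doubleHarmonic (p - 1) s t - (harmonicPow (p - 1) (s + t) -
      p * (s * doubleHarmonic (p - 1) (s + 1) t + t * doubleHarmonic (p - 1) s (t + 1))) ∈
      primePowMultiples p 2 := by
  have h1 := doubleHarmonic_swap_sub_mem (p := p) hst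
  have h2 := doubleHarmonic_add_swap (p - 1) s t
  have h3 := mul_mem_primePowMultiples (harmonicPow_mem_primePowMultiples_one hs hsp)
    (harmonicPow_mem_primePowMultiples_one ht htp)
  convert sub_mem h3 h1 using 1
  linear_combination h2

/-- Reflection makes twice the sum congruent to `-s p` times the power sum of exponent `s + 1`,
itself divisible by `p`. -/
theorem harmonicPow_odd_mem {s : ℕ} (hs : Odd s) (hsp : s + 2 < p) :
    harmonicPow (p - 1) s ∈ primePowMultiples p 2 := by
  refine mem_primePowMultiples_of_natCast_mul_mem (k := 2) two_pos (by omega) ?_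
  have h1 : harmonicPow (p - 1) s +
      (harmonicPow (p - 1) s + s * (p * harmonicPow (p - 1) (s + 1))) ∈ primePowMultiples p 2 := by
    nth_rw 1 [harmonicPow]
    rw [← sum_Icc_prime_sub]
    simp only [harmonicPow, mul_sum, ← sum_add_distrib]
    refine sum_mem fun k hk => ?_
    obtain ⟨hk, hkp⟩ := pos_and_lt_of_mem_Icc hk
    convert inv_prime_sub_pow_sub_mem hk hkp s using 1
    rw [hs.neg_one_pow]
    ring
  have h2 := mul_mem_left_primePowMultiples (natCast_mem_primePowMultiples_zero s)
    (prime_mul_mem_primePowMultiples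
    (harmonicPow_mem_primePowMultiples_one (p := p) (Nat.succ_pos s) (by omega)))
  convert sub_mem h1 h2 using 1
  push_cast
  ring

theorem harmonicPow_prime_sub_add_mem {s k : ℕ} (hs : 0 < s) (hsp : s + 1 < p) (hk : 0 < k)
    (hkp : k < p) :
    harmonicPow (p - k) s + (-1) ^ s * (harmonicPow k s - ((k : ℚ)⁻¹) ^ s) ∈
      primePowMultiples p 1 := by
  have h1 := harmonicPow_mem_primePowMultiples_one hs hsp
  have h2 : harmonicPow (p - 1) s = harmonicPow (p - k) s +
      ∑ j ∈ Icc 1 (k - 1), (((p - j : ℕ) : ℚ)⁻¹) ^ s := by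
    rw [sum_Icc_sub_reflect (fun j => ((j : ℚ)⁻¹) ^ s) hkp.le, harmonicPow, harmonicPow]
    rw [← sum_union]
    · congr 1; ext; simp; omega
    · rw [disjoint_left]; intro a; simp; omega
  have h3 : harmonicPow k s - ((k : ℚ)⁻¹) ^ s = ∑ j ∈ Icc 1 (k - 1), ((j : ℚ)⁻¹) ^ s := by
    obtain ⟨k, rfl⟩ : ∃ i, k = i + 1 := ⟨k - 1, by omega⟩
    simp [harmonicPow, sum_Icc_succ_top]
  have h4 : ∑ j ∈ Icc 1 (k - 1), (((p - j : ℕ) : ℚ)⁻¹) ^ s -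
      (-1) ^ s * (harmonicPow k s - ((k : ℚ)⁻¹) ^ s) ∈ primePowMultiples p 1 := by
    rw [h3, mul_sum, ← sum_sub_distrib]
    refine sum_mem fun j hj => ?_
    simp at hj
    exact inv_prime_sub_pow_sub_mem_one (by omega) (by omega) s
  convert sub_mem h1 h4 using 1
  rw [h2]
  ring

/-- Under `k ↦ p - k` the partial sums up to `k` become, up to sign, those up to `k - 1`. Even
weight makes the total sign `-1`, so the triple products cancel and only the diagonal corrections
remain. -/
theorem two_mul_tripleHarmonic_sub_mem {s t : ℕ} (hs : 0 < s)
    (hst : Even (s + t)) (hstp : s + t + 2 < p) :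
    2 * (∑ k ∈ Icc 1 (p - 1), ((k : ℚ)⁻¹) ^ t * harmonicPow k 1 * harmonicPow k s) -
      (doubleHarmonic (p - 1) 1 (s + t) + doubleHarmonic (p - 1) s (t + 1)) ∈
      primePowMultiples p 1 := by
  have h1 := harmonicPow_mem_primePowMultiples_one (p := p) (s := s + t + 1) (by omega) hstp
  set A := ∑ k ∈ Icc 1 (p - 1), ((k : ℚ)⁻¹) ^ t * harmonicPow k 1 * harmonicPow k s with hA
  have h2 : A = ∑ k ∈ Icc 1 (p - 1),
      (((p - k : ℕ) : ℚ)⁻¹) ^ t * harmonicPow (p - k) 1 * harmonicPow (p - k) s :=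
    (sum_Icc_prime_sub (fun k => ((k : ℚ)⁻¹) ^ t * harmonicPow k 1 * harmonicPow k s)).symm
  have h3 : ∑ k ∈ Icc 1 (p - 1),
      ((k : ℚ)⁻¹) ^ t * (harmonicPow k 1 - (k : ℚ)⁻¹) * (harmonicPow k s - ((k : ℚ)⁻¹) ^ s) =
      A - (doubleHarmonic (p - 1) 1 (s + t) + doubleHarmonic (p - 1) s (t + 1)) +
        harmonicPow (p - 1) (s + t + 1) := by
    rw [hA, doubleHarmonic, doubleHarmonic, harmonicPow]
    simp only [← sum_add_distrib, ← sum_sub_distrib]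
    refine sum_congr rfl fun k _ => by ring
  have h4 : A + ∑ k ∈ Icc 1 (p - 1), ((k : ℚ)⁻¹) ^ t * (harmonicPow k 1 - (k : ℚ)⁻¹) *
      (harmonicPow k s - ((k : ℚ)⁻¹) ^ s) ∈ primePowMultiples p 1 := by
    rw [h2, ← sum_add_distrib]
    refine sum_mem fun k hk => ?_
    obtain ⟨hk, hkp⟩ := pos_and_lt_of_mem_Icc hk
    have a1 := inv_prime_sub_pow_sub_mem_one hk hkp t
    have a2 := harmonicPow_prime_sub_add_mem (s := 1) one_pos (by omega) hk hkp
    have a3 := harmonicPow_prime_sub_add_mem hs (by omega) hk hkp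
    rw [pow_one, pow_one] at a2
    have b1 := harmonicPow_mem_primePowMultiples_zero (p := p) (n := p - k) (by omega) 1
    have b2 := harmonicPow_mem_primePowMultiples_zero (p := p) (n := p - k) (by omega) s
    have b3 := harmonicPow_mem_primePowMultiples_zero hkp 1
    have c := inv_natCast_mem_primePowMultiples_zero hk hkp
    have ct := neg_one_pow_mem_primePowMultiples_zero (p := p) t
    have hsg : (-1 : ℚ) ^ s * (-1) ^ t = 1 := by rw [← pow_add, hst.neg_one_pow]
    set x := (k : ℚ)⁻¹
    set y := ((p - k : ℕ) : ℚ)⁻¹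
    have m := add_mem (add_mem
      (mul_mem_right_primePowMultiples a1 (mul_mem_left_primePowMultiples b1 b2))
      (mul_mem_left_primePowMultiples (mul_mem_left_primePowMultiples ct
        (pow_mem_primePowMultiples_zero c t)) (mul_mem_right_primePowMultiples a2 b2)))
      (mul_mem_left_primePowMultiples (mul_mem_left_primePowMultiples ct
        (pow_mem_primePowMultiples_zero c t)) (mul_mem_left_primePowMultiples
        (sub_mem b3 c) a3))
    convert m using 1
    linear_combination (-x ^ t * (harmonicPow k 1 - x) * (harmonicPow k s - x ^ s)) * hsg
  rw [h3] at h4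
  convert sub_mem h4 h1 using 1
  ring

end Congruences

/-! ### Generating functions, duality and Newton's identity. -/

open PowerSeries in
/-- The power series `∏_{i ∈ s} (1 - X / i)`. -/
noncomputable def oneSubProd (s : Finset ℕ) : PowerSeries ℚ :=
  ∏ i ∈ s, (1 - C ((i : ℚ)⁻¹) * X)

/-- The generating series of `a ↦ S({1}^a)` over the interval `[m, n]`. -/
noncomputable def starOnesSeries (m n : ℕ) : PowerSeries ℚ :=
  PowerSeries.mk fun a => intervalSum Icc m n (List.replicate a 1)

/-- The signed generating series of `a ↦ H({1}^a)` over the interval `(m, n)`. -/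
noncomputable def onesSeries (m n : ℕ) : PowerSeries ℚ :=
  PowerSeries.mk fun a => (-1) ^ a * intervalSum Ioo m n (List.replicate a 1)

theorem intervalSum_Icc_replicate_succ {m n : ℕ} (hmn : m ≤ n + 1) (a : ℕ) :
    intervalSum Icc m (n + 1) (List.replicate (a + 1) 1) =
      intervalSum Icc m n (List.replicate (a + 1) 1) +
        ((n + 1 : ℕ) : ℚ)⁻¹ * intervalSum Icc m (n + 1) (List.replicate a 1) := by
  rw [List.replicate_succ', intervalSum_Icc_append_singleton, intervalSum_Icc_append_singleton,
    sum_Icc_succ_top hmn, pow_one]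

theorem intervalSum_Ioo_replicate_succ {m n : ℕ} (hmn : m < n) (a : ℕ) :
    intervalSum Ioo m (n + 1) (List.replicate (a + 1) 1) =
      intervalSum Ioo m n (List.replicate (a + 1) 1) +
        (n : ℚ)⁻¹ * intervalSum Ioo m n (List.replicate a 1) := by
  have h : Ioo m (n + 1) = insert n (Ioo m n) := by ext; simp; omega
  rw [List.replicate_succ', intervalSum_Ioo_append_cons, intervalSum_Ioo_append_cons, h,
    sum_insert (by simp)]
  simp [intervalSum, add_comm]

open PowerSeries in
theorem one_sub_mul_starOnesSeries {m n : ℕ} (hmn : m ≤ n + 1) :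
    (1 - C (((n + 1 : ℕ) : ℚ)⁻¹) * X) * starOnesSeries m (n + 1) = starOnesSeries m n := by
  ext a
  rw [sub_mul, one_mul, mul_assoc, map_sub, coeff_C_mul]
  rcases a with _ | a
  · simp [starOnesSeries, intervalSum]
  · rw [coeff_succ_X_mul]
    simp only [starOnesSeries, coeff_mk]
    rw [intervalSum_Icc_replicate_succ hmn]
    ring

open PowerSeries in
theorem onesSeries_succ {m n : ℕ} (hmn : m < n) :
    onesSeries m (n + 1) = (1 - C ((n : ℚ)⁻¹) * X) * onesSeries m n := by
  ext a
  rw [sub_mul, one_mul, mul_assoc, map_sub, coeff_C_mul]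
  rcases a with _ | a
  · simp [onesSeries, intervalSum]
  · rw [coeff_succ_X_mul]
    simp only [onesSeries, coeff_mk]
    rw [intervalSum_Ioo_replicate_succ hmn]
    ring

theorem starOnesSeries_mul_oneSubProd {m n : ℕ} (hmn : m ≤ n + 1) :
    starOnesSeries m n * oneSubProd (Icc m n) = 1 := by
  induction n, (show m - 1 ≤ n by omega) using Nat.le_induction with
  | base =>
    -- For `m = 0` truncated subtraction starts the induction at the interval `{0}`, where `0⁻¹ = 0`
    -- makes both factors trivial.
    rcases m with _ | m
    · ext a
      rcases a with _ | a
      · simp [starOnesSeries, oneSubProd, intervalSum]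
      · simp [starOnesSeries, oneSubProd, PowerSeries.coeff_one, List.replicate_succ, intervalSum]
    · ext a
      rcases a with _ | a
      · simp [starOnesSeries, oneSubProd, intervalSum]
      · simp [starOnesSeries, oneSubProd, PowerSeries.coeff_one, List.replicate_succ, intervalSum]
  | succ n hn ih =>
    rw [oneSubProd, ← insert_Icc_right_eq_Icc_add_one (by omega), prod_insert (by simp),
      mul_left_comm, ← mul_assoc, mul_comm _ (starOnesSeries _ _), mul_comm (starOnesSeries _ _),
      one_sub_mul_starOnesSeries (by omega)]
    exact ih (by omega)

theorem onesSeries_eq_oneSubProd {m n : ℕ} (hmn : m < n) :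
    onesSeries m n = oneSubProd (Ioo m n) := by
  induction n, hmn using Nat.le_induction with
  | base =>
    ext a
    rcases a with _ | a
    · simp [onesSeries, oneSubProd, intervalSum]
    · have h : Ioo m (m + 1) = ∅ := by ext; simp
      simp [onesSeries, oneSubProd, PowerSeries.coeff_one, List.replicate_succ, intervalSum, h]
  | succ n hn ih =>
    have h : Ioo m (n + 1) = insert n (Ioo m n) := by ext; simp; omega
    rw [onesSeries_succ hn, ih, oneSubProd, oneSubProd, h, prod_insert (by simp)]

/-- The product of `1/(1 - X/i)` over `i ≤ k` is the full product over `i ≤ n` times the factors `1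
- X/i` with `i > k`. A star sum below `k` thereby becomes a strict sum above `k`, which is why the
two blocks of ones trade places. -/
theorem starOnesSeries_eq_lower {k n : ℕ} (hkn : k ≤ n) :
    starOnesSeries 1 k = onesSeries k (n + 1) * starOnesSeries 1 n := by
  have h1 : oneSubProd (Icc 1 n) = oneSubProd (Icc 1 k) * oneSubProd (Ioo k (n + 1)) := by
    rw [oneSubProd, oneSubProd, oneSubProd, ← prod_union]
    · congr 1; ext; simp; omega
    · rw [disjoint_left]; intro a; simp; omega
  have h2 := starOnesSeries_mul_oneSubProd (m := 1) (n := n) (by omega)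
  have h3 := starOnesSeries_mul_oneSubProd (m := 1) (n := k) (by omega)
  rw [onesSeries_eq_oneSubProd (by omega)]
  rw [h1] at h2
  linear_combination (-starOnesSeries 1 k) * h2 +
    (oneSubProd (Ioo k (n + 1)) * starOnesSeries 1 n) * h3

theorem starOnesSeries_eq_upper {k n : ℕ} (hk : 1 ≤ k) (hkn : k ≤ n) :
    starOnesSeries k n = onesSeries 0 k * starOnesSeries 1 n := by
  have h1 : oneSubProd (Icc 1 n) = oneSubProd (Icc k n) * oneSubProd (Ioo 0 k) := by
    rw [oneSubProd, oneSubProd, oneSubProd, ← prod_union]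
    · congr 1; ext; simp; omega
    · rw [disjoint_left]; intro a; simp; omega
  have h2 := starOnesSeries_mul_oneSubProd (m := 1) (n := n) (by omega)
  have h3 := starOnesSeries_mul_oneSubProd (m := k) (n := n) (by omega)
  rw [onesSeries_eq_oneSubProd (by omega)]
  rw [h1] at h2
  linear_combination (-starOnesSeries k n) * h2 +
    (oneSubProd (Ioo 0 k) * starOnesSeries 1 n) * h3

theorem intervalSum_Icc_onesTwoOnes_eq_sum (a b n : ℕ) :
    intervalSum Icc 1 n (onesTwoOnes a b) =
      ∑ x ∈ antidiagonal a, ∑ y ∈ antidiagonal b,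
        (-1) ^ (x.1 + y.1) * intervalSum Ioo 0 (n + 1) (onesTwoOnes y.1 x.1) *
          (intervalSum Icc 1 n (List.replicate x.2 1) *
            intervalSum Icc 1 n (List.replicate y.2 1)) := by
  have key : ∀ k ∈ Icc 1 n, ((k : ℚ)⁻¹) ^ 2 * intervalSum Icc 1 k (List.replicate a 1) *
      intervalSum Icc k n (List.replicate b 1) =
      ∑ x ∈ antidiagonal a, ∑ y ∈ antidiagonal b, (-1) ^ (x.1 + y.1) *
        (((k : ℚ)⁻¹) ^ 2 * intervalSum Ioo 0 k (List.replicate y.1 1) *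
          intervalSum Ioo k (n + 1) (List.replicate x.1 1)) *
          (intervalSum Icc 1 n (List.replicate x.2 1) *
            intervalSum Icc 1 n (List.replicate y.2 1)) := by
    intro k hk
    have hk := mem_Icc.1 hk
    have h1 := congrArg (PowerSeries.coeff a) (starOnesSeries_eq_lower hk.2)
    have h2 := congrArg (PowerSeries.coeff b) (starOnesSeries_eq_upper hk.1 hk.2)
    rw [PowerSeries.coeff_mul] at h1 h2
    simp only [starOnesSeries, onesSeries, PowerSeries.coeff_mk] at h1 h2
    rw [h1, h2, mul_assoc, sum_mul_sum, mul_sum]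
    refine sum_congr rfl fun x _ => ?_
    rw [mul_sum]
    exact sum_congr rfl fun y _ => by rw [pow_add]; ring
  rw [onesTwoOnes, intervalSum_Icc_append_cons, sum_congr rfl key, sum_comm]
  refine sum_congr rfl fun x _ => ?_
  rw [sum_comm]
  refine sum_congr rfl fun y _ => ?_
  rw [← sum_mul, ← mul_sum, onesTwoOnes, intervalSum_Ioo_append_cons,
    show Ioo 0 (n + 1) = Icc 1 n by ext; simp; omega]

/-- The generating series of the power sums `i ↦ ∑_{j=1}^n j^{-i}`, without constant term. -/
noncomputable def harmonicPowSeries (n : ℕ) : PowerSeries ℚ :=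
  PowerSeries.mk fun i => if i = 0 then 0 else harmonicPow n i

open PowerSeries in
-- The logarithmic derivative of the product of `1/(1 - X/i)`; its coefficients are Newton's
-- identities for complete homogeneous sums.
theorem X_mul_derivative_starOnesSeries (n : ℕ) :
    X * d⁄dX ℚ (starOnesSeries 1 n) = starOnesSeries 1 n * harmonicPowSeries n := by
  induction n with
  | zero =>
    have h := starOnesSeries_mul_oneSubProd (m := 1) (n := 0) le_rfl
    have h1 : starOnesSeries 1 0 = 1 := by simpa [oneSubProd] using h
    have h2 : harmonicPowSeries 0 = 0 := by ext i; simp [harmonicPowSeries, harmonicPow]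
    rw [h1, h2]
    simp
  | succ n ih =>
    set c : ℚ := ((n + 1 : ℕ) : ℚ)⁻¹ with hc
    have h1 : (1 - C c * X) * starOnesSeries 1 (n + 1) = starOnesSeries 1 n :=
      one_sub_mul_starOnesSeries (by omega)
    have h2 : (1 - C c * X) * (harmonicPowSeries (n + 1) - harmonicPowSeries n) = C c * X := by
      ext i
      rw [sub_mul, one_mul, mul_assoc]
      simp only [map_sub, coeff_C_mul]
      rcases i with _ | i
      · simp [harmonicPowSeries]
      · rw [coeff_succ_X_mul, coeff_X]
        rcases i with _ | i
        · simp [harmonicPowSeries, harmonicPow, sum_Icc_succ_top, hc]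
        · simp only [harmonicPowSeries, harmonicPow, sum_Icc_succ_top (Nat.le_add_left 1 n), hc,
            coeff_mk, Nat.succ_ne_zero, if_false]
          generalize ((n + 1 : ℕ) : ℚ)⁻¹ = d
          simp
          ring
    have h3 : (1 - C c * X) * d⁄dX ℚ (starOnesSeries 1 (n + 1)) -
        C c * starOnesSeries 1 (n + 1) = d⁄dX ℚ (starOnesSeries 1 n) := by
      rw [← h1, Derivation.leibniz]
      simp only [map_sub, Derivation.leibniz, derivative_C, derivative_X, smul_eq_mul,
        Derivation.map_one_eq_zero]
      ring
    have hne : (1 - C c * X : PowerSeries ℚ) ≠ 0 := by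
      intro h
      have := congrArg (coeff 0) h
      simp at this
    refine mul_left_cancel₀ hne ?_
    linear_combination X * h3 + ih - harmonicPowSeries n * h1 - starOnesSeries 1 (n + 1) * h2

theorem mul_intervalSum_replicate_one_eq_sum (n w : ℕ) :
    (w : ℚ) * intervalSum Icc 1 n (List.replicate w 1) =
      ∑ x ∈ antidiagonal w, intervalSum Icc 1 n (List.replicate x.1 1) *
        (if x.2 = 0 then 0 else harmonicPow n x.2) := by
  have h := congrArg (PowerSeries.coeff w) (X_mul_derivative_starOnesSeries n)
  rw [PowerSeries.coeff_mul _ (starOnesSeries 1 n)] at h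
  simp only [starOnesSeries, harmonicPowSeries, PowerSeries.coeff_mk] at h
  rw [← h]
  rcases w with _ | w
  · simp
  · rw [PowerSeries.coeff_succ_X_mul, PowerSeries.coeff_derivative, PowerSeries.coeff_mk]
    push_cast
    ring

/-! ### All-ones star sums and even power sums modulo `p²`. -/

section Congruences

variable {p : ℕ} [hp : Fact p.Prime]

theorem intervalSum_replicate_one_mem_zero (j : ℕ) :
    intervalSum Icc 1 (p - 1) (List.replicate j 1) ∈ primePowMultiples p 0 := by
  rw [intervalSum_Icc_replicate_one _ (by have := hp.out.two_le; omega)]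
  refine sum_mem fun k hk => ?_
  have := pos_and_lt_of_mem_Icc hk
  exact mul_mem_left_primePowMultiples (mul_mem_left_primePowMultiples
    (neg_one_pow_mem_primePowMultiples_zero _) (natCast_mem_primePowMultiples_zero _))
    (inv_pow_mem_primePowMultiples_zero this.1 this.2 _)

theorem intervalSum_replicate_one_mem_one {j : ℕ} (hj : 0 < j) (hjp : j + 1 < p) :
    intervalSum Icc 1 (p - 1) (List.replicate j 1) ∈ primePowMultiples p 1 := by
  rw [intervalSum_Icc_replicate_one _ (by have := hp.out.two_le; omega)]
  have h := binomTransform_add_mem_one (p := p) (f := fun k => ((k : ℚ)⁻¹) ^ j)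
    fun k hk hkp => inv_pow_mem_primePowMultiples_zero hk hkp j
  have h2 := sub_mem h (harmonicPow_mem_primePowMultiples_one hj hjp)
  rw [harmonicPow, add_sub_cancel_right] at h2
  exact h2

theorem intervalSum_replicate_one_sub_mem (j : ℕ) :
    intervalSum Icc 1 (p - 1) (List.replicate j 1) -
      (p * doubleHarmonic (p - 1) 1 j - harmonicPow (p - 1) j) ∈ primePowMultiples p 2 := by
  rw [intervalSum_Icc_replicate_one _ (by have := hp.out.two_le; omega)]
  have h := binomTransform_sub_mem (p := p) (f := fun k => ((k : ℚ)⁻¹) ^ j)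
    fun k hk hkp => inv_pow_mem_primePowMultiples_zero hk hkp j
  simp only [mul_comm (harmonicPow _ 1)] at h
  exact h

theorem bernoulli_prime_sub_eq_zero {w : ℕ} (hw0 : 0 < w) (hw : Even w) (hwp : w + 1 < p) :
    bernoulli (p - w) = 0 := by
  rcases hp.out.eq_two_or_odd' with h | h
  · omega
  · exact bernoulli_eq_zero_of_odd (Nat.Odd.sub_even (by omega) h hw) (by omega)

theorem doubleHarmonic_mem_one {s t : ℕ} (hs : 0 < s) (ht : 0 < t) (hst : s + t + 1 < p)
    (he : Even (s + t)) : doubleHarmonic (p - 1) s t ∈ primePowMultiples p 1 := by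
  have h := doubleHarmonic_sub_mem hs ht hst
  rwa [bernoulli_prime_sub_eq_zero (by omega) he hst, mul_zero, sub_zero] at h

theorem intervalSum_replicate_one_mem_two {j : ℕ} (hj : Odd j) (hjp : j + 2 < p) :
    intervalSum Icc 1 (p - 1) (List.replicate j 1) ∈ primePowMultiples p 2 := by
  have h := intervalSum_replicate_one_sub_mem (p := p) j
  have h1 := prime_mul_mem_primePowMultiples (doubleHarmonic_mem_one (p := p) one_pos hj.pos
    (by omega) (by rw [add_comm]; exact hj.add_one))
  have h2 := harmonicPow_odd_mem hj hjp
  convert add_mem h (sub_mem h1 h2) using 1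
  ring

/-- In Newton's identity every mixed product has both factors divisible by `p`. -/
theorem mul_intervalSum_replicate_one_sub_mem {w : ℕ} (hw : 0 < w) (hwp : w < p) :
    (w : ℚ) * intervalSum Icc 1 (p - 1) (List.replicate w 1) - harmonicPow (p - 1) w ∈
      primePowMultiples p 2 := by
  rw [mul_intervalSum_replicate_one_eq_sum,
    ← add_sum_erase _ _ (show (0, w) ∈ antidiagonal w by simp)]
  simp only [hw.ne', if_false, List.replicate_zero, intervalSum, one_mul, add_sub_cancel_left]
  refine sum_mem fun x hx => ?_
  have hx1 := mem_antidiagonal.1 (mem_of_mem_erase hx)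
  have hx2 : x.1 ≠ 0 := fun h => ne_of_mem_erase hx (Prod.ext h (by change x.2 = w; omega))
  split_ifs with h
  · simp
  · exact mul_mem_primePowMultiples (intervalSum_replicate_one_mem_one (by omega) (by omega))
      (harmonicPow_mem_primePowMultiples_one (by omega) (by omega))

/-- Newton gives `w S({1}^w) ≡ H(w)` and the binomial transform gives `S({1}^w) ≡ p D(1,w) - H(w)`;
eliminating `S({1}^w)` determines the power sum `H(w)`, since `D(1,w) ≡ B_{p-1-w}` mod `p`. -/
theorem mul_harmonicPow_even_sub_mem {w : ℕ} (hw : Even w) (hw0 : 0 < w) (hwp : w + 2 < p) :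
    ((w : ℚ) + 1) * harmonicPow (p - 1) w - w * (p * bernoulli (p - (w + 1))) ∈
      primePowMultiples p 2 := by
  have h1 := mul_intervalSum_replicate_one_sub_mem (p := p) hw0 (by omega)
  have h2 := intervalSum_replicate_one_sub_mem (p := p) w
  have h3 := doubleHarmonic_sub_mem (p := p) one_pos hw0 (by omega)
  have h4 : (-1) ^ w * ((1 + w).choose w : ℚ) / (((1 : ℕ) : ℚ) + w) = 1 := by
    have : (1 : ℚ) + w ≠ 0 := by positivity
    rw [hw.neg_one_pow, add_comm 1 w, Nat.choose_succ_self_right]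
    push_cast
    field_simp
    ring
  rw [h4, one_mul, add_comm 1 w] at h3
  have hwz := natCast_mem_primePowMultiples_zero (p := p) w
  convert add_mem (sub_mem (mul_mem_left_primePowMultiples hwz h2) h1)
    (mul_mem_left_primePowMultiples hwz (prime_mul_mem_primePowMultiples h3)) using 1
  ring

theorem add_mul_doubleHarmonic_sub_mem {s t : ℕ} (hs : 0 < s) (ht : 0 < t) (hst : s + t + 1 < p) :
    ((s : ℚ) + t) * doubleHarmonic (p - 1) s t -
      (-1) ^ t * ((s + t).choose t : ℚ) * bernoulli (p - (s + t)) ∈ primePowMultiples p 1 := by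
  have h := mul_mem_left_primePowMultiples (natCast_mem_primePowMultiples_zero (s + t))
    (doubleHarmonic_sub_mem hs ht hst)
  convert h using 1
  have : (s : ℚ) + t ≠ 0 := by positivity
  push_cast
  field_simp

/-! ### The congruences for the star sums. -/

theorem intervalSum_Icc_onesTwoOnes_add_mem {a b : ℕ} :
    intervalSum Icc 1 (p - 1) (onesTwoOnes a b) + doubleHarmonic (p - 1) (a + 1) (b + 1) ∈
      primePowMultiples p 1 := by
  rw [intervalSum_Icc_onesTwoOnes]
  exact binomTransform_add_mem_one fun k hk hkp => mul_mem_left_primePowMultiples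
    (inv_pow_mem_primePowMultiples_zero hk hkp _) (harmonicPow_mem_primePowMultiples_zero hkp _)

theorem intervalSum_Icc_onesTwoOnes_sub_mem_one {a b : ℕ} (hab : a + b + 3 < p) :
    intervalSum Icc 1 (p - 1) (onesTwoOnes a b) -
      (-1) ^ b / ((a : ℚ) + b + 2) * ((a + b + 2).choose (a + 1) : ℚ)
        * bernoulli (p - (a + b + 2)) ∈ primePowMultiples p 1 := by
  have h1 := intervalSum_Icc_onesTwoOnes_add_mem (p := p) (a := a) (b := b)
  have h2 := doubleHarmonic_sub_mem (p := p) (s := a + 1) (t := b + 1) (by omega) (by omega)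
    (by omega)
  rw [show a + 1 + (b + 1) = a + b + 2 by ring,
    show (a + b + 2).choose (b + 1) = (a + b + 2).choose (a + 1) from
      Nat.choose_symm_of_eq_add (by ring)] at h2
  convert sub_mem h1 h2 using 1
  push_cast
  rw [show (a : ℚ) + 1 + (b + 1) = a + b + 2 by ring]
  ring

theorem intervalSum_Icc_onesTwoOnes_sub_mem_two {a b : ℕ} (he : Even (a + b))
    (hab : a + b + 4 < p) :
    intervalSum Icc 1 (p - 1) (onesTwoOnes a b) -
      (p : ℚ) * bernoulli (p - (a + b + 3)) / (2 * ((a : ℚ) + b + 3))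
            * (1 + (-1 : ℚ) ^ a * ((a + b + 3).choose (a + 2) : ℚ)) ∈ primePowMultiples p 2 := by
  have hw : Even (a + 1 + (b + 1)) := by
    rw [show a + 1 + (b + 1) = a + b + 2 by ring]
    exact he.add even_two
  have h0 := binomTransform_sub_mem (p := p)
    (f := fun k => ((k : ℚ)⁻¹) ^ (b + 1) * harmonicPow k (a + 1))
    fun k hk hkp => mul_mem_left_primePowMultiples
    (inv_pow_mem_primePowMultiples_zero hk hkp _) (harmonicPow_mem_primePowMultiples_zero hkp _)
  have hA : ∑ k ∈ Icc 1 (p - 1), harmonicPow k 1 * (((k : ℚ)⁻¹) ^ (b + 1) * harmonicPow k (a + 1)) =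
      ∑ k ∈ Icc 1 (p - 1), ((k : ℚ)⁻¹) ^ (b + 1) * harmonicPow k 1 * harmonicPow k (a + 1) :=
    sum_congr rfl fun k _ => by ring
  have hS : binomTransform (fun k => ((k : ℚ)⁻¹) ^ (b + 1) * harmonicPow k (a + 1)) (p - 1) =
      intervalSum Icc 1 (p - 1) (onesTwoOnes a b) := (intervalSum_Icc_onesTwoOnes a b _).symm
  have hD : ∑ k ∈ Icc 1 (p - 1), ((k : ℚ)⁻¹) ^ (b + 1) * harmonicPow k (a + 1) =
      doubleHarmonic (p - 1) (a + 1) (b + 1) := rfl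
  rw [hA, hS, hD] at h0
  have h1 := two_mul_tripleHarmonic_sub_mem (p := p) (s := a + 1) (t := b + 1) (by omega) hw
    (by omega)
  have h2 := two_mul_doubleHarmonic_sub_mem (p := p) (s := a + 1) (t := b + 1) (by omega)
    (by omega) (by omega) (by omega) hw
  have h3 := mul_harmonicPow_even_sub_mem (p := p) hw (by omega) (by omega)
  have d1 := add_mul_doubleHarmonic_sub_mem (p := p) (s := 1) (t := a + 1 + (b + 1)) (by omega)
    (by omega) (by omega)
  have d2 := add_mul_doubleHarmonic_sub_mem (p := p) (s := a + 1) (t := b + 1 + 1) (by omega)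
    (by omega) (by omega)
  have d3 := add_mul_doubleHarmonic_sub_mem (p := p) (s := a + 1 + 1) (t := b + 1) (by omega)
    (by omega) (by omega)
  have c1 : ((1 + (a + 1 + (b + 1))).choose (a + 1 + (b + 1)) : ℚ) = a + b + 3 := by
    rw [add_comm 1, Nat.choose_succ_self_right]
    push_cast
    ring
  have c2 : ((a + b + 3).choose (b + 1 + 1) : ℚ) * ((b : ℚ) + 2) =
      (a + b + 3).choose (a + 2) * ((a : ℚ) + 2) := by
    have := Nat.choose_succ_right_eq (a + b + 3) (b + 1)
    rw [show a + b + 3 - (b + 1) = a + 2 by omega,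
      show (a + b + 3).choose (b + 1) = (a + b + 3).choose (a + 2) from
        Nat.choose_symm_of_eq_add (by ring)] at this
    exact_mod_cast this
  rw [hw.neg_one_pow, c1, show 1 + (a + 1 + (b + 1)) = a + b + 3 by ring] at d1
  rw [show a + 1 + (b + 1 + 1) = a + b + 3 by ring] at d2
  rw [show a + 1 + 1 + (b + 1) = a + b + 3 by ring,
    show (a + b + 3).choose (b + 1) = (a + b + 3).choose (a + 2) from
        Nat.choose_symm_of_eq_add (by ring)] at d3
  rw [show a + 1 + (b + 1) + 1 = a + b + 3 by ring] at h3
  have hab' : (-1 : ℚ) ^ b = (-1) ^ a := by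
    have h : (-1 : ℚ) ^ a * (-1) ^ b = 1 := by rw [← pow_add, he.neg_one_pow]
    rcases neg_one_pow_eq_or ℚ a with h' | h' <;> rw [h'] at h ⊢ <;> linarith
  -- Multiplying by `2(a + b + 3)`, a unit at `p`, clears every denominator. The Bernoulli terms
  -- then collect to `1 + (-1)^a ((b+2) C(a+b+3,b+2) - (a+1) C(a+b+3,a+2))`, which `c2` simplifies.
  refine mem_primePowMultiples_of_natCast_mul_mem (k := a + b + 3) (by omega) (by omega) ?_
  refine mem_primePowMultiples_of_natCast_mul_mem (k := 2) (by omega) (by omega) ?_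
  have hN (n : ℕ) := natCast_mem_primePowMultiples_zero (p := p) n
  have m := add_mem (add_mem (add_mem (sub_mem (sub_mem (add_mem
    (mul_mem_left_primePowMultiples (hN (2 * (a + b + 3))) h0)
    (mul_mem_left_primePowMultiples (hN (a + b + 3)) (prime_mul_mem_primePowMultiples h1)))
    (mul_mem_left_primePowMultiples (hN (a + b + 3)) h2)) h3)
    (prime_mul_mem_primePowMultiples d1))
    (mul_mem_left_primePowMultiples (hN (b + 2)) (prime_mul_mem_primePowMultiples d2)))
    (mul_mem_left_primePowMultiples (hN (a + 1)) (prime_mul_mem_primePowMultiples d3))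
  convert m using 1
  have hW : (a : ℚ) + b + 3 ≠ 0 := by positivity
  have e : ((2 : ℕ) : ℚ) * (((a + b + 3 : ℕ) : ℚ) * (intervalSum Icc 1 (p - 1) (onesTwoOnes a b) -
      (p : ℚ) * bernoulli (p - (a + b + 3)) / (2 * ((a : ℚ) + b + 3))
            * (1 + (-1 : ℚ) ^ a * ((a + b + 3).choose (a + 2) : ℚ)))) =
      2 * ((a : ℚ) + b + 3) * intervalSum Icc 1 (p - 1) (onesTwoOnes a b) -
      (p : ℚ) * bernoulli (p - (a + b + 3))
            * (1 + (-1 : ℚ) ^ a * ((a + b + 3).choose (a + 2) : ℚ)) := by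
    push_cast
    field_simp
  rw [e]
  push_cast
  simp only [pow_succ, hab']
  linear_combination (p * bernoulli (p - (a + b + 3)) * (-1) ^ a) * c2

/-! ### Duality modulo `p` and `p²`. -/

theorem intervalSum_Ioo_mem_zero {m n : ℕ} (hn : n ≤ p) (s : List ℕ) :
    intervalSum Ioo m n s ∈ primePowMultiples p 0 := by
  induction s generalizing m with
  | nil => exact one_mem_primePowMultiples_zero
  | cons t s ih =>
    refine sum_mem fun k hk => mul_mem_left_primePowMultiples ?_ ih
    rw [mem_Ioo] at hk
    exact inv_pow_mem_primePowMultiples_zero (by omega) (by omega) t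

theorem intervalSum_onesTwoOnes_Icc_sub_Ioo_eq_sum (a b n : ℕ) :
    intervalSum Icc 1 n (onesTwoOnes a b) -
        (-1) ^ (a + b) * intervalSum Ioo 0 (n + 1) (onesTwoOnes b a) =
      ∑ x ∈ (antidiagonal a ×ˢ antidiagonal b).erase ((a, 0), (b, 0)),
        (-1) ^ (x.1.1 + x.2.1) * intervalSum Ioo 0 (n + 1) (onesTwoOnes x.2.1 x.1.1) *
          (intervalSum Icc 1 n (List.replicate x.1.2 1) *
            intervalSum Icc 1 n (List.replicate x.2.2 1)) := by
  rw [intervalSum_Icc_onesTwoOnes_eq_sum, ← sum_product',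
    ← add_sum_erase _ _ (show ((a, 0), (b, 0)) ∈ antidiagonal a ×ˢ antidiagonal b by simp)]
  simp [intervalSum]

theorem intervalSum_onesTwoOnes_Icc_sub_Ioo_mem_one {a b : ℕ} (hab : a + b + 3 < p) :
    intervalSum Icc 1 (p - 1) (onesTwoOnes a b) -
        (-1) ^ (a + b) * intervalSum Ioo 0 (p - 1 + 1) (onesTwoOnes b a) ∈
      primePowMultiples p 1 := by
  rw [intervalSum_onesTwoOnes_Icc_sub_Ioo_eq_sum]
  refine sum_mem fun x hx => ?_
  obtain ⟨⟨j, c⟩, ⟨l, d⟩⟩ := x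
  simp only [mem_erase, mem_product, HasAntidiagonal.mem_antidiagonal, ne_eq, Prod.mk.injEq] at hx
  dsimp only
  refine mul_mem_left_primePowMultiples (mul_mem_left_primePowMultiples
    (neg_one_pow_mem_primePowMultiples_zero _) (intervalSum_Ioo_mem_zero (by omega) _)) ?_
  rcases Nat.eq_zero_or_pos c with hc | hc
  · exact mul_mem_left_primePowMultiples (intervalSum_replicate_one_mem_zero _)
      (intervalSum_replicate_one_mem_one (by omega) (by omega))
  · exact mul_mem_right_primePowMultiples (intervalSum_replicate_one_mem_one hc (by omega))
      (intervalSum_replicate_one_mem_zero _)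

theorem neg_one_pow_mul_mem_iff {n m : ℕ} {x : ℚ} :
    (-1) ^ n * x ∈ primePowMultiples p m ↔ x ∈ primePowMultiples p m := by
  rcases neg_one_pow_eq_or ℚ n with h | h <;> simp [h]

theorem intervalSum_Ioo_onesTwoOnes_mem_one {a b : ℕ} (hab : a + b + 3 < p) (he : Even (a + b)) :
    intervalSum Ioo 0 (p - 1 + 1) (onesTwoOnes b a) ∈ primePowMultiples p 1 := by
  have h1 := intervalSum_onesTwoOnes_Icc_sub_Ioo_mem_one hab
  have h2 := intervalSum_Icc_onesTwoOnes_add_mem (p := p) (a := a) (b := b)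
  have h3 := doubleHarmonic_mem_one (p := p) (s := a + 1) (t := b + 1) (by omega) (by omega)
    (by omega) (by
      rw [show a + 1 + (b + 1) = a + b + 2 by ring]
      exact he.add even_two)
  rw [← neg_one_pow_mul_mem_iff (n := a + b)]
  convert sub_mem (sub_mem h2 h3) h1 using 1
  ring

/-- Each extra term has two factors `p`: two nonempty all-ones sums give one each, and a single one
of odd length gives `p²`. One of even length gives `p`, and the accompanying strict sum, again of
even weight, gives the other. -/
theorem intervalSum_onesTwoOnes_Icc_sub_Ioo_mem_two {a b : ℕ} (hab : a + b + 3 < p)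
    (he : Even (a + b)) :
    intervalSum Icc 1 (p - 1) (onesTwoOnes a b) -
        intervalSum Ioo 0 (p - 1 + 1) (onesTwoOnes b a) ∈ primePowMultiples p 2 := by
  have h := intervalSum_onesTwoOnes_Icc_sub_Ioo_eq_sum a b (p - 1)
  rw [he.neg_one_pow, one_mul] at h
  rw [h]
  refine sum_mem fun x hx => ?_
  obtain ⟨⟨j, c⟩, ⟨l, d⟩⟩ := x
  simp only [mem_erase, mem_product, HasAntidiagonal.mem_antidiagonal, ne_eq, Prod.mk.injEq] at hx
  rw [mul_assoc, neg_one_pow_mul_mem_iff]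
  dsimp only
  have hH := intervalSum_Ioo_mem_zero (p := p) (m := 0) (n := p - 1 + 1) (by omega) (onesTwoOnes l j)
  have hcz := intervalSum_replicate_one_mem_zero (p := p) c
  have hdz := intervalSum_replicate_one_mem_zero (p := p) d
  rcases Nat.eq_zero_or_pos c with hc | hc
  · rcases Nat.even_or_odd d with hd | hd
    · refine mul_mem_primePowMultiples (m := 1) (n := 1)
        (intervalSum_Ioo_onesTwoOnes_mem_one (by omega) ?_) (mul_mem_left_primePowMultiples hcz
        (intervalSum_replicate_one_mem_one (by omega) (by omega)))
      rw [Nat.even_iff] at *; omega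
    · exact mul_mem_left_primePowMultiples hH (mul_mem_left_primePowMultiples hcz
        (intervalSum_replicate_one_mem_two hd (by omega)))
  · rcases Nat.eq_zero_or_pos d with hd | hd
    · rcases Nat.even_or_odd c with hc' | hc'
      · refine mul_mem_primePowMultiples (m := 1) (n := 1)
          (intervalSum_Ioo_onesTwoOnes_mem_one (by omega) ?_) (mul_mem_right_primePowMultiples
          (intervalSum_replicate_one_mem_one (by omega) (by omega)) hdz)
        rw [Nat.even_iff] at *; omega
      · exact mul_mem_left_primePowMultiples hH (mul_mem_right_primePowMultiples
          (intervalSum_replicate_one_mem_two hc' (by omega)) hdz)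
    · exact mul_mem_left_primePowMultiples hH (mul_mem_primePowMultiples (m := 1) (n := 1)
        (intervalSum_replicate_one_mem_one hc (by omega))
        (intervalSum_replicate_one_mem_one hd (by omega)))

end Congruences

/-! ### Conclusion: the strict sums from the star sums with `a` and `b` exchanged. -/

theorem theoremT3p2 (a b p : ℕ) (hp : p.Prime) (hab : a + b + 3 < p) :
    (Odd (a + b) →
      RatCongr p 1 (multStarHarmonicSum (p - 1) (onesTwoOnes a b))
          ((-1 : ℚ) ^ b / ((a : ℚ) + b + 2) * ((a + b + 2).choose (a + 1) : ℚ)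
            * bernoulli (p - a - b - 2)) ∧
      RatCongr p 1 (multHarmonicSum (p - 1) (onesTwoOnes a b))
          ((-1 : ℚ) ^ b / ((a : ℚ) + b + 2) * ((a + b + 2).choose (a + 1) : ℚ)
            * bernoulli (p - a - b - 2))) ∧
    (Even (a + b) →
      RatCongr p 2 (multStarHarmonicSum (p - 1) (onesTwoOnes a b))
          ((p : ℚ) * bernoulli (p - a - b - 3) / (2 * ((a : ℚ) + b + 3))
            * (1 + (-1 : ℚ) ^ a * ((a + b + 3).choose (a + 2) : ℚ))) ∧
      RatCongr p 2 (multHarmonicSum (p - 1) (onesTwoOnes a b))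
          ((p : ℚ) * bernoulli (p - a - b - 3) / (2 * ((a : ℚ) + b + 3))
            * (1 + (-1 : ℚ) ^ a * ((a + b + 3).choose (b + 2) : ℚ)))) := by
  have : Fact p.Prime := ⟨hp⟩
  simp only [ratCongr_iff_sub_mem, multStarHarmonicSum_eq_intervalSum,
    multHarmonicSum_eq_intervalSum, Nat.sub_sub]
  refine ⟨fun ho => ⟨intervalSum_Icc_onesTwoOnes_sub_mem_one hab, ?_⟩, fun he => ?_⟩
  · have h1 := intervalSum_Icc_onesTwoOnes_sub_mem_one (p := p) (a := b) (b := a) (by omega)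
    have h2 := intervalSum_onesTwoOnes_Icc_sub_Ioo_mem_one (p := p) (a := b) (b := a) (by omega)
    have hs : (-1 : ℚ) ^ b = -(-1) ^ a := by
      have h : (-1 : ℚ) ^ a * (-1) ^ b = -1 := by rw [← pow_add, ho.neg_one_pow]
      rcases neg_one_pow_eq_or ℚ a with h' | h' <;> rw [h'] at h ⊢ <;> linarith
    rw [add_comm b a, ho.neg_one_pow] at h2
    rw [add_comm b a, show (a + b + 2).choose (b + 1) = (a + b + 2).choose (a + 1) from
      Nat.choose_symm_of_eq_add (by ring)] at h1
    convert sub_mem h2 h1 using 1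
    rw [hs, add_comm (b : ℚ) a]
    ring
  -- For even `a + b` the case `p = a + b + 4` would make `p` an even prime, hence `2`, which is too
  -- small.
  · have hlt : a + b + 4 < p := by
      refine lt_of_le_of_ne hab fun h => ?_
      have h2 : p = 2 := hp.even_iff.1 (h ▸ he.add (by decide))
      omega
    refine ⟨intervalSum_Icc_onesTwoOnes_sub_mem_two he hlt, ?_⟩
    have he' : Even (b + a) := by rwa [add_comm]
    have h1 := intervalSum_Icc_onesTwoOnes_sub_mem_two (p := p) he' (by omega)
    have h2 := intervalSum_onesTwoOnes_Icc_sub_Ioo_mem_two (p := p) (a := b) (b := a) (by omega) he'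
    have hs : (-1 : ℚ) ^ b = (-1) ^ a := by
      have h : (-1 : ℚ) ^ a * (-1) ^ b = 1 := by rw [← pow_add, he.neg_one_pow]
      rcases neg_one_pow_eq_or ℚ a with h' | h' <;> rw [h'] at h ⊢ <;> linarith
    rw [hs, add_comm b a, add_comm (b : ℚ) a] at h1
    convert sub_mem h1 h2 using 1
    ring
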